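/- Let $0\le n\le p$ be integers and let $t_{-1}\le t_0\le\dots\le t_{p+n+1}\le t_{p+n+2}$ be real knots with $a:=t_n<b:=t_{p+1}$. Write $\langle x\rangle^k$ for $x$ repeated $k$ times and $N^d_{i,K}$ for the $i$-th normalized B-spline basis function of degree $d$ over a knot vector $K$ (its value at $b$ being understood as the limit from the left). Consider either the *general* knot vectors $$\mu=\{t_k\}_{k=0}^{p+n+1},\quad \nu=\{\langle t_k\rangle^{n+1}\}_{k=0}^{p+n+1},\quad \rho=\{t_{-1},\{\langle t_k\rangle^{n+1}\}_{k=0}^{p+n+1},t_{p+n+2}\},$$ $$\tau=\{\langle t_{-1}\rangle^{2n+1},\{\langle t_k\rangle^{3n+2}\}_{k=0}^{p+n+1},\langle t_{p+n+2}\rangle^{2n+1}\},\quad q=(n+1)(p+n),\quad w=(3n+2)(p+n+2)-1,$$ or the *clamped* knot vectors, which have the form $\{\langle t_n\rangle^{e},\{\langle t_k\rangle^{c}\}_{k=n+1}^{p},\langle t_{p+1}\rangle^{e}\}$ with $(e,c)=(n+1,1)$ for $\mu$, $(2n+1,n+1)$ for $\nu$, $(2n+2,n+1)$ for $\rho$,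 $(4n+2,3n+2)$ for $\tau$, and $q=2n+(n+1)(p-n)$, $w=4n+1+(p-n)(3n+2)$. Let $s_0,s_1,\dots$ be the knots of $\nu$. In both cases: (1) There are real coefficients $\chi^{i,j}_k=\chi^{j,i}_k$ and $\zeta^{i,j}_k$ with $$N^n_{i,\mu}N^n_{j,\mu}=\sum_{k=0}^q\chi^{i,j}_kN^{2n}_{k,\nu}\quad(0\le i,j\le p),\qquad N^{2n+1}_{i,\rho}N^{2n}_{j,\nu}=\sum_{k=0}^w\zeta^{i,j}_kN^{4n+1}_{k,\tau}\quad(0\le i\le q+1,\ 0\le j\le q).$$ If $s_k<s_{k+2n+1}$ for all $0\le k\le q$, then the Gram matrix $\big(\int N^{2n}_{k,\nu}N^{2n}_{l,\nu}\big)_{k,l}$ is nonsingular, and $(c_k)$ are coefficients of the product $N^n_{i,\mu}N^n_{j,\mu}$ in the basis $N^{2n}_{k,\nu}$ if and only if they solve the linear system with this matrix and right-hand side $\big(\int N^n_{i,\mu}N^n_{j,\mu}N^{2n}_{l,\nu}\big)_l$. Likewise for $N^{2n+1}_{i,\rho}N^{2n}_{j,\nu}$ and the basis $N^{4n+1}_{k,\tau}$,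 if $\tau_k<\tau_{k+4n+2}$ for all $0\le k\le w$. The integrals are over the interval from the first to the last knot of $\nu$, respectively $\tau$. (2) Let $\chi,\zeta$ be any coefficients as in (1), let $z(t)=\sum_{i=0}^p z_iN^n_{i,\mu}(t)$ with $z_i\in\mathbb C$, and let $r:[a,b]\to\mathbb C$ be a regular PH B-spline curve with $r'=z^2$, that is, $r$ is differentiable with this derivative (one-sided at $a,b$) and $z\ne0$ on $[a,b]$. Put $$p_k=\sum_{i,j=0}^p\chi^{i,j}_kz_iz_j,\qquad \sigma_k=\sum_{i,j=0}^p\chi^{i,j}_kz_i\bar z_j\in\mathbb R,$$ $$r_{i+1}=r_i+\tfrac{s_{i+2n+1}-s_i}{2n+1}\,p_i,\qquad l_0=0,\quad l_{i+1}=l_i+\tfrac{s_{i+2n+1}-s_i}{2n+1}\,\sigma_i\qquad(0\le i\le q).$$ Then for all $t,\xi\in[a,b]$ $$|r'(t)|=\sum_{k=0}^q\sigma_kN^{2n}_{k,\nu}(t),\qquad \int_a^\xi|r'(t)|\,dt=\sum_{i=0}^{q+1}l_i\big(N^{2n+1}_{i,\rho}(\xi)-N^{2n+1}_{i,\rho}(a)\big),$$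 and there is a unique $r_0\in\mathbb C$ with $r(t)=\sum_{i=0}^{q+1}r_iN^{2n+1}_{i,\rho}(t)$ on $[a,b]$. With this $r_0$, for every $h\in\mathbb R$ the offset curve $r_h=r+h\,\frac{-\mathrm i\,r'}{|r'|}$ is, on $[a,b]$, the rational B-spline (NURBS) curve of degree $4n+1$ over $\tau$ $$r_h(t)=\frac{\sum_{k=0}^wq_kN^{4n+1}_{k,\tau}(t)}{\sum_{k=0}^w\gamma_kN^{4n+1}_{k,\tau}(t)},\qquad \gamma_k=\sum_{i=0}^{q+1}\sum_{j=0}^q\sigma_j\zeta^{i,j}_k,\qquad q_k=\sum_{i=0}^{q+1}\sum_{j=0}^q(\sigma_jr_i-\mathrm i\,h\,p_j)\,\zeta^{i,j}_k,$$ and its denominator is positive on $[a,b]$. -/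

import Mathlib

open Set MeasureTheory

noncomputable section

namespace PHSpline

/-- The `i`-th normalized B-spline basis function of degree `d` over the knots `K 0 ≤ K 1 ≤ ⋯`,
by the usual recursion (the convention `x / 0 = 0` is the usual `0/0 = 0`). -/
def bspline (K : ℕ → ℝ) : ℕ → ℕ → ℝ → ℝ
  | 0, i, x => if K i ≤ x ∧ x < K (i + 1) then 1 else 0
  | d + 1, i, x =>
      (x - K i) / (K (i + d + 1) - K i) * bspline K d i x
        + (K (i + d + 2) - x) / (K (i + d + 2) - K (i + 1)) * bspline K d (i + 1) x

/-- The basis function `bspline K d i`, as used for spline functions on a domain `[a, b]`: at the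
right end point `b` (and only there) its value is the limit from the left. This changes nothing
where the basis function is continuous at `b`; for knot vectors in which `b` has full multiplicity
(clamped curves) it makes the curve reach its last control point at `b`. -/
def basisOn (b : ℝ) (K : ℕ → ℝ) (d i : ℕ) : ℝ → ℝ :=
  Function.update (bspline K d i) b (Function.leftLim (bspline K d i) b)

/-- `f = ∑_{k=0}^{N} c_k N_k^d` over the knots `K`. -/
def IsExpansion (b : ℝ) (K : ℕ → ℝ) (d N : ℕ) (c : ℕ → ℝ) (f : ℝ → ℝ) : Prop :=
  ∀ x, f x = ∑ k ∈ Finset.range (N + 1), c k * basisOn b K d k x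

/-- The Gram matrix of `N_0^d, …, N_N^d` for the `L²` inner product on the interval spanned by the
knots `K 0, …, K (N + d + 1)`. -/
def gram (K : ℕ → ℝ) (d N : ℕ) : Matrix (Fin (N + 1)) (Fin (N + 1)) ℝ :=
  Matrix.of fun k l => ∫ x in (K 0)..(K (N + d + 1)), bspline K d k x * bspline K d l x

/-- The inner products of `f` with `N_0^d, …, N_N^d`. -/
def moments (K : ℕ → ℝ) (d N : ℕ) (f : ℝ → ℝ) : Fin (N + 1) → ℝ :=
  fun l => ∫ x in (K 0)..(K (N + d + 1)), f x * bspline K d l x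

/-- The knot vectors belonging to a PH B-spline curve: `μ` for the preimage `z`, `ν` for the
hodograph `z²` and the parametric speed (basis indices `0, …, q`), `ρ` for the curve and its arc
length (basis indices `0, …, q + 1`), `τ` for the offset curves (basis indices `0, …, w`). -/
structure Knots where
  μ : ℕ → ℝ
  ν : ℕ → ℝ
  ρ : ℕ → ℝ
  τ : ℕ → ℝ
  q : ℕ
  w : ℕ

/-- The general construction, from knots `t_{-1} ≤ t_0 ≤ ⋯ ≤ t_{p+n+1} ≤ t_{p+n+2}`
(`⟨x⟩^k` is `x` repeated `k` times):
`μ = {t_0, …, t_{p+n+1}}`, `ν = {⟨t_k⟩^{n+1}}_{k=0..p+n+1}`,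
`ρ = {t_{-1}, {⟨t_k⟩^{n+1}}_{k=0..p+n+1}, t_{p+n+2}}`,
`τ = {⟨t_{-1}⟩^{2n+1}, {⟨t_k⟩^{3n+2}}_{k=0..p+n+1}, ⟨t_{p+n+2}⟩^{2n+1}}`.
The divisions are floor divisions of integers; entries beyond the last knot are not used. -/
def Knots.general (n p : ℕ) (t : ℤ → ℝ) : Knots where
  μ i := t i
  ν i := t ((i : ℤ) / (n + 1))
  ρ i := t (((i : ℤ) - 1) / (n + 1))
  τ i := t (((i : ℤ) - (2 * n + 1)) / (3 * n + 2))
  q := (n + 1) * (p + n)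
  w := (3 * n + 2) * (p + n + 2) - 1

/-- The knot vector `{⟨t_n⟩^e, {⟨t_k⟩^c}_{k=n+1..m}, ⟨t_{m+1}⟩^e}`. -/
def clampedVec (n m : ℕ) (t : ℤ → ℝ) (e c : ℕ) (i : ℕ) : ℝ :=
  if i < e then t n else t (min (m + 1) (n + 1 + (i - e) / c) : ℕ)

/-- The construction for clamped curves (with the redundant knots removed):
`μ = {⟨t_n⟩^{n+1}, {t_k}_{k=n+1..m}, ⟨t_{m+1}⟩^{n+1}}`, and likewise `ν`, `ρ`, `τ` with
multiplicities `2n+1`, `2n+2`, `4n+2` at the ends and `n+1`, `n+1`, `3n+2` inside. -/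
def Knots.clamped (n m : ℕ) (t : ℤ → ℝ) : Knots where
  μ := clampedVec n m t (n + 1) 1
  ν := clampedVec n m t (2 * n + 1) (n + 1)
  ρ := clampedVec n m t (2 * n + 2) (n + 1)
  τ := clampedVec n m t (4 * n + 2) (3 * n + 2)
  q := 2 * n + (n + 1) * (m - n)
  w := 4 * n + 1 + (m - n) * (3 * n + 2)

/-- `χ i j k` are coefficients, symmetric in `i, j`, with
`N_{i,μ}^n N_{j,μ}^n = ∑_{k=0}^{q} χ_k^{i,j} N_{k,ν}^{2n}` for `0 ≤ i, j ≤ p`. -/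
structure Knots.IsChi (S : Knots) (n p : ℕ) (b : ℝ) (χ : ℕ → ℕ → ℕ → ℝ) : Prop where
  symm : ∀ i ≤ p, ∀ j ≤ p, ∀ k ≤ S.q, χ i j k = χ j i k
  expand : ∀ i ≤ p, ∀ j ≤ p, IsExpansion b S.ν (2 * n) S.q (χ i j)
    fun x => basisOn b S.μ n i x * basisOn b S.μ n j x

/-- `ζ i j k` are coefficients with
`N_{i,ρ}^{2n+1} N_{j,ν}^{2n} = ∑_{k=0}^{w} ζ_k^{i,j} N_{k,τ}^{4n+1}`
for `0 ≤ i ≤ q + 1` and `0 ≤ j ≤ q`. -/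
def Knots.IsZeta (S : Knots) (n : ℕ) (b : ℝ) (ζ : ℕ → ℕ → ℕ → ℝ) : Prop :=
  ∀ i ≤ S.q + 1, ∀ j ≤ S.q, IsExpansion b S.τ (4 * n + 1) S.w (ζ i j)
    fun x => basisOn b S.ρ (2 * n + 1) i x * basisOn b S.ν (2 * n) j x

/-- `z(x) = ∑_{i=0}^{p} z_i N_{i,μ}^n(x)`, a complex (that is, planar) B-spline curve. -/
def preimage (n p : ℕ) (b : ℝ) (μ : ℕ → ℝ) (z : ℕ → ℂ) (x : ℝ) : ℂ :=
  ∑ i ∈ Finset.range (p + 1), z i * (basisOn b μ n i x : ℂ)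

/-- `r` is a regular planar PH B-spline curve on `[a, b]` with preimage `z`: `r' = z²` and `z` has
no zero. The derivative is one-sided at the end points. -/
structure IsRegularPH (n p : ℕ) (a b : ℝ) (μ : ℕ → ℝ) (z : ℕ → ℂ) (r : ℝ → ℂ) : Prop where
  hodograph : ∀ x ∈ Icc a b, HasDerivWithinAt r (preimage n p b μ z x ^ 2) (Icc a b) x
  regular : ∀ x ∈ Icc a b, preimage n p b μ z x ≠ 0

/-- The parametric speed `|r'|` of a curve on `[a, b]`. -/
def speed (a b : ℝ) (r : ℝ → ℂ) (x : ℝ) : ℝ := ‖derivWithin r (Icc a b) x‖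

/-- The offset curve `r + h n`, with unit normal `n = (y', -x') / |r'| = -i r' / |r'|`. -/
def offset (a b : ℝ) (r : ℝ → ℂ) (h x : ℝ) : ℂ :=
  r x + h * (-Complex.I * derivWithin r (Icc a b) x / (speed a b r x : ℂ))

/-- `p_k = ∑_{i,j} χ_k^{i,j} z_i z_j`, the control points of the hodograph. -/
def hodoCoeff (p : ℕ) (χ : ℕ → ℕ → ℕ → ℝ) (z : ℕ → ℂ) (k : ℕ) : ℂ :=
  ∑ i ∈ Finset.range (p + 1), ∑ j ∈ Finset.range (p + 1), (χ i j k : ℂ) * z i * z j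

/-- `σ_k = ∑_{i,j} χ_k^{i,j} z_i conj(z_j)`, the coefficients of the parametric speed. The sum is
real because `χ` is symmetric in `i, j` (see `speedCoeff_eq`), so only real parts are written. -/
def speedCoeff (p : ℕ) (χ : ℕ → ℕ → ℕ → ℝ) (z : ℕ → ℂ) (k : ℕ) : ℝ :=
  ∑ i ∈ Finset.range (p + 1), ∑ j ∈ Finset.range (p + 1),
    χ i j k * (z i * (starRingEnd ℂ) (z j)).re

/-- `r_{i+1} = r_i + (s_{i+2n+1} - s_i) / (2n+1) p_i`, with `ν = {s_i}`. -/
def curveCoeff (n : ℕ) (ν : ℕ → ℝ) (P : ℕ → ℂ) (r₀ : ℂ) : ℕ → ℂ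
  | 0 => r₀
  | i + 1 => curveCoeff n ν P r₀ i + ((ν (i + 2 * n + 1) - ν i) / (2 * n + 1) : ℝ) * P i

/-- `l_0 = 0`, `l_{i+1} = l_i + (s_{i+2n+1} - s_i) / (2n+1) σ_i`, with `ν = {s_i}`. -/
def arcCoeff (n : ℕ) (ν : ℕ → ℝ) (σ : ℕ → ℝ) : ℕ → ℝ
  | 0 => 0
  | i + 1 => arcCoeff n ν σ i + (ν (i + 2 * n + 1) - ν i) / (2 * n + 1) * σ i

/-- The weights `γ_k = ∑_{i=0}^{q+1} ∑_{j=0}^{q} σ_j ζ_k^{i,j}`. -/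
def weight (q : ℕ) (ζ : ℕ → ℕ → ℕ → ℝ) (σ : ℕ → ℝ) (k : ℕ) : ℝ :=
  ∑ i ∈ Finset.range (q + 2), ∑ j ∈ Finset.range (q + 1), σ j * ζ i j k

/-- The control points `q_k = ∑_{i=0}^{q+1} ∑_{j=0}^{q} (σ_j r_i - i h p_j) ζ_k^{i,j}`. -/
def offsetCoeff (q : ℕ) (ζ : ℕ → ℕ → ℕ → ℝ) (σ : ℕ → ℝ) (R P : ℕ → ℂ) (h : ℝ) (k : ℕ) : ℂ :=
  ∑ i ∈ Finset.range (q + 2), ∑ j ∈ Finset.range (q + 1),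
    ((σ j : ℂ) * R i - Complex.I * (h : ℂ) * P j) * (ζ i j k : ℂ)

theorem speedCoeff_eq (S : Knots) (n p : ℕ) (b : ℝ) (χ : ℕ → ℕ → ℕ → ℝ)
    (hχ : S.IsChi n p b χ) (z : ℕ → ℂ) (k : ℕ) (hk : k ≤ S.q) :
    (speedCoeff p χ z k : ℂ) =
      ∑ i ∈ Finset.range (p + 1), ∑ j ∈ Finset.range (p + 1),
        (χ i j k : ℂ) * z i * (starRingEnd ℂ) (z j) := by
  apply Complex.ext
  · simp [speedCoeff, Complex.re_sum, mul_assoc]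
  · rw [Complex.ofReal_im]
    set A : ℝ := (∑ i ∈ Finset.range (p + 1), ∑ j ∈ Finset.range (p + 1),
        (χ i j k : ℂ) * z i * (starRingEnd ℂ) (z j)).im with hA
    have h1 : A = ∑ i ∈ Finset.range (p + 1), ∑ j ∈ Finset.range (p + 1),
        χ i j k * ((z i).im * (z j).re - (z i).re * (z j).im) := by
      rw [hA, Complex.im_sum]
      refine Finset.sum_congr rfl fun i _ => ?_
      rw [Complex.im_sum]
      refine Finset.sum_congr rfl fun j _ => ?_
      simp
      ring
    have h2 : A = -A := by
      conv_lhs => rw [h1, Finset.sum_comm]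
      rw [h1, ← Finset.sum_neg_distrib]
      refine Finset.sum_congr rfl fun i hi => ?_
      rw [← Finset.sum_neg_distrib]
      refine Finset.sum_congr rfl fun j hj => ?_
      rw [hχ.symm j (by simpa [Nat.lt_succ_iff] using hj) i
        (by simpa [Nat.lt_succ_iff] using hi) k hk]
      ring
    linarith

end PHSpline

end

/-! Everything rests on recognising splines by the contact of their polynomial pieces at knots. On a
nonempty knot interval, Marsden's identity `marsden` expands (X - x)^d in knot polynomials. Pairing
it with a polynomial through the apolar form gives the de Boor–Fix functionals `dual`, which compute
B-spline coefficients from one polynomial piece (`eq_sum_dual`, `dual_piece`). At a knot x of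
multiplicity M, a polynomial of degree at most d is divisible by (X - x)^(d+1-M) exactly when the
functionals of the B-splines straddling x annihilate it (`Brackets.dual_eq_zero`,
`Brackets.dvd_of_dual_eq_zero`). Applied to the jump between adjacent pieces, one direction gives
the smoothness of B-splines. The other makes the coefficients of a spline independent of the
interval, which yields the Curry–Schoenberg theorem `IsSpline.exists_eq_sum`.

A product of splines of degrees d, e with multiplicities M, M' has the contact of a spline of degree
d + e with multiplicity max(e + M, d + M') (`IsSpline.mul`). Counting multiplicities in the knot
vectors therefore gives χ and ζ. Linear independence of nondegenerate B-splines makes the Gram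
matrices nonsingular.

The same χ expands both z² = r' and z·conj z = |r'|. Integration takes degree 2n over ν to degree 2n
+ 1 over ρ (`integral_bspline`), with partial sums as coefficients. Finally r_h = (r|r'| - i h r') /
|r'|. The terms r' and |r'| are multiplied by the partition of unity over ρ, so every term becomes a
combination of products that ζ expands. -/

namespace PHSpline

open Polynomial Topology Filter

/-! ### Polynomial pieces of B-splines and Marsden's identity. -/

/-- The polynomial that agrees with `bspline K d i` on the knot interval `[K m, K (m + 1))`. -/
noncomputable def piece (K : ℕ → ℝ) : ℕ → ℕ → ℕ → ℝ[X]
  | 0, i, m => if i = m then 1 else 0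
  | d + 1, i, m =>
      C (K (i + d + 1) - K i)⁻¹ * (X - C (K i)) * piece K d i m
        + C (K (i + d + 2) - K (i + 1))⁻¹ * (C (K (i + d + 2)) - X) * piece K d (i + 1) m

theorem bspline_eq_piece {K : ℕ → ℝ} (hK : Monotone K) {m : ℕ} {x : ℝ} (h₁ : K m ≤ x)
    (h₂ : x < K (m + 1)) (d i : ℕ) : bspline K d i x = (piece K d i m).eval x := by
  induction d generalizing i with
  | zero =>
    have : (K i ≤ x ∧ x < K (i + 1)) ↔ i = m := by
      constructor
      · rintro ⟨h₃, h₄⟩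
        have h₅ : i < m + 1 := hK.reflect_lt (h₃.trans_lt h₂)
        have h₆ : m < i + 1 := hK.reflect_lt (h₁.trans_lt h₄)
        omega
      · rintro rfl
        exact ⟨h₁, h₂⟩
    simp only [bspline, piece, this]
    split_ifs <;> simp
  | succ d ih =>
    simp only [bspline, piece, ih, eval_add, eval_mul, eval_sub, eval_C, eval_X]
    ring

theorem piece_eq_zero_of_lt (K : ℕ → ℝ) {d i m : ℕ} (h : m < i) : piece K d i m = 0 := by
  induction d generalizing i with
  | zero => simp [piece, h.ne']
  | succ d ih => simp [piece, ih h, ih (h.trans (Nat.lt_succ_self i))]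

theorem piece_eq_zero_of_add_lt (K : ℕ → ℝ) {d i m : ℕ} (h : i + d < m) : piece K d i m = 0 := by
  induction d generalizing i with
  | zero => simp [piece, (show i ≠ m by omega)]
  | succ d ih => simp [piece, ih (show i + d < m by omega), ih (show i + 1 + d < m by omega)]

theorem le_of_piece_ne_zero {K : ℕ → ℝ} {d i m : ℕ} (h : piece K d i m ≠ 0) :
    i ≤ m ∧ m ≤ i + d := by
  constructor
  · by_contra! h'
    exact h (piece_eq_zero_of_lt K h')
  · by_contra! h'
    exact h (piece_eq_zero_of_add_lt K h')

theorem natDegree_piece_le (K : ℕ → ℝ) (d i m : ℕ) : (piece K d i m).natDegree ≤ d := by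
  induction d generalizing i with
  | zero => simp only [piece]; split_ifs <;> simp
  | succ d ih =>
    simp only [piece]
    refine natDegree_add_le_of_degree_le ?_ ?_
    · refine (natDegree_mul_le).trans ?_
      have h₁ : (C (K (i + d + 1) - K i)⁻¹ * (X - C (K i))).natDegree ≤ 1 :=
        (natDegree_C_mul_le _ _).trans (natDegree_X_sub_C_le _)
      have := ih i
      omega
    · refine (natDegree_mul_le).trans ?_
      have h₁ : (C (K (i + d + 2) - K (i + 1))⁻¹ * (C (K (i + d + 2)) - X)).natDegree ≤ 1 := by
        refine (natDegree_C_mul_le _ _).trans ?_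
        rw [natDegree_sub]
        exact natDegree_X_sub_C_le _
      have := ih (i + 1)
      omega

/-- The polynomial `∏_{r=1}^{d} (X - K (k + r))` of Marsden's identity. -/
noncomputable def knotPoly (K : ℕ → ℝ) (d k : ℕ) : ℝ[X] :=
  ∏ r ∈ Finset.range d, (X - C (K (k + r + 1)))

theorem knotPoly_succ (K : ℕ → ℝ) (d k : ℕ) :
    knotPoly K (d + 1) k = knotPoly K d k * (X - C (K (k + d + 1))) := by
  rw [knotPoly, Finset.prod_range_succ, knotPoly]

theorem knotPoly_succ' (K : ℕ → ℝ) (d k : ℕ) :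
    knotPoly K (d + 1) k = (X - C (K (k + 1))) * knotPoly K d (k + 1) := by
  rw [knotPoly, Finset.prod_range_succ', mul_comm, knotPoly]
  congr 1
  refine Finset.prod_congr rfl fun r _ => ?_
  rw [show k + 1 + r + 1 = k + (r + 1) + 1 by omega]

theorem monic_knotPoly (K : ℕ → ℝ) (d k : ℕ) : (knotPoly K d k).Monic :=
  monic_prod_of_monic _ _ fun _ _ => monic_X_sub_C _

theorem natDegree_knotPoly (K : ℕ → ℝ) (d k : ℕ) : (knotPoly K d k).natDegree = d := by
  rw [knotPoly, natDegree_prod_of_monic _ _ fun _ _ => monic_X_sub_C _]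
  simp

/-- **Marsden's identity** on a nonempty knot interval. -/
theorem marsden {K : ℕ → ℝ} (hK : Monotone K) {d m N : ℕ} (hd : d ≤ m) (hm : K m < K (m + 1))
    (hN : m < N) (x : ℝ) :
    ∑ k ∈ Finset.range N, C ((piece K d k m).eval x) * knotPoly K d k = (X - C x) ^ d := by
  induction d generalizing N with
  | zero => simp [piece, knotPoly, apply_ite, hN]
  | succ d ih =>
    -- Both boundary terms of the index shift vanish because `d + 1 ≤ m < N`.
    have h0 : piece K d 0 m = 0 := piece_eq_zero_of_add_lt K (by omega)
    have hlast : piece K d N m = 0 := piece_eq_zero_of_lt K hN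
    have hshift : ∀ f : ℕ → ℝ[X], f 0 = 0 → f N = 0 →
        ∑ k ∈ Finset.range N, f k = ∑ k ∈ Finset.range N, f (k + 1) := by
      intro f h₁ h₂
      have := Finset.sum_range_succ' f N
      rw [Finset.sum_range_succ, h₁, h₂] at this
      simpa using this
    have ih' := ih (by omega) hN
    rw [hshift _ (by simp [h0]) (by simp [hlast])] at ih'
    rw [pow_succ, ← ih', Finset.sum_mul]
    have hsplit : ∀ k, C ((piece K (d + 1) k m).eval x) * knotPoly K (d + 1) k =
        C ((x - K k) / (K (k + d + 1) - K k) * (piece K d k m).eval x) * knotPoly K (d + 1) k +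
        C ((K (k + d + 2) - x) / (K (k + d + 2) - K (k + 1)) * (piece K d (k + 1) m).eval x) *
          knotPoly K (d + 1) k := by
      intro k
      rw [← add_mul, ← C_add]
      congr 2
      simp only [piece, eval_add, eval_mul, eval_sub, eval_C, eval_X]
      ring
    simp only [hsplit]
    rw [Finset.sum_add_distrib, hshift _ (by simp [h0]) (by simp [hlast]),
      ← Finset.sum_add_distrib]
    -- After the shift both recursion terms carry `piece K d (k + 1) m`. With α = `K (k + 1)` and β
    -- = `K (k + d + 2)` they combine by (x-α)/(β-α)·(X-β) + (β-x)/(β-α)·(X-α) = X - x.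
    refine Finset.sum_congr rfl fun k _ => ?_
    by_cases hz : piece K d (k + 1) m = 0
    · simp [hz]
    obtain ⟨h₁, h₂⟩ := le_of_piece_ne_zero hz
    have hlt : K (k + 1) < K (k + d + 2) :=
      (hK h₁).trans_lt (hm.trans_le (hK (by omega)))
    have hne : K (k + d + 2) - K (k + 1) ≠ 0 := (sub_pos.2 hlt).ne'
    rw [knotPoly_succ K d (k + 1), knotPoly_succ' K d k,
      show k + 1 + d + 1 = k + d + 2 by omega]
    have e₁ : (x - K (k + 1)) / (K (k + d + 2) - K (k + 1)) =
        1 - (K (k + d + 2) - x) / (K (k + d + 2) - K (k + 1)) := by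
      field_simp
      ring
    have e₂ : C x = C (K (k + d + 2)) - C ((K (k + d + 2) - x) / (K (k + d + 2) - K (k + 1))) *
        (C (K (k + d + 2)) - C (K (k + 1))) := by
      rw [← C_sub, ← C_mul, div_mul_cancel₀ _ hne, ← C_sub]
      congr 1
      ring
    rw [e₂, e₁]
    simp only [C_mul, C_sub, C_1]
    ring

/-! ### The apolar pairing and the dual functionals. -/

/-- The apolar pairing `∑_{v=0}^{d} (-1)^v ψ^{(d-v)} P^{(v)}` of polynomials. It is constant if both
arguments have degree at most `d`. -/
noncomputable def apolar (d : ℕ) : ℝ[X] →ₗ[ℝ] ℝ[X] →ₗ[ℝ] ℝ[X] :=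
  ∑ v ∈ Finset.range (d + 1), (-1 : ℝ) ^ v •
    (LinearMap.mul ℝ ℝ[X]).compl₁₂ (derivative ^ (d - v)) (derivative ^ v)

theorem apolar_apply (d : ℕ) (ψ P : ℝ[X]) : apolar d ψ P =
    ∑ v ∈ Finset.range (d + 1), (-1 : ℝ) ^ v • (derivative^[d - v] ψ * derivative^[v] P) := by
  simp [apolar, LinearMap.sum_apply, Module.End.pow_apply]

/-- The alternating signs make the derivative telescope; each of the two boundary terms contains a
derivative of order d + 1. -/
theorem derivative_apolar {d : ℕ} {ψ P : ℝ[X]} (hψ : ψ.natDegree ≤ d) (hP : P.natDegree ≤ d) :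
    derivative (apolar d ψ P) = 0 := by
  set g : ℕ → ℝ[X] := fun v =>
    (-1 : ℝ) ^ v • (derivative^[d + 1 - v] ψ * derivative^[v] P) with hg
  have h : ∀ v ∈ Finset.range (d + 1),
      derivative ((-1 : ℝ) ^ v • (derivative^[d - v] ψ * derivative^[v] P)) = g v - g (v + 1) := by
    intro v hv
    have hv' : v ≤ d := by simpa [Nat.lt_succ_iff] using hv
    simp only [hg]
    rw [derivative_smul, derivative_mul, ← Function.iterate_succ_apply' derivative,
      ← Function.iterate_succ_apply' derivative, show d + 1 - v = (d - v).succ by omega,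
      show d + 1 - (v + 1) = d - v by omega, pow_succ, mul_neg_one, neg_smul, sub_neg_eq_add,
      ← smul_add]
  rw [apolar_apply, derivative_sum, Finset.sum_congr rfl h, Finset.sum_range_sub']
  have h₁ : derivative^[d + 1] ψ = 0 := iterate_derivative_eq_zero (by omega)
  have h₂ : derivative^[d + 1] P = 0 := iterate_derivative_eq_zero (by omega)
  simp [hg, h₁, h₂]

theorem eval_apolar_eq {d : ℕ} {ψ P : ℝ[X]} (hψ : ψ.natDegree ≤ d) (hP : P.natDegree ≤ d)
    (x y : ℝ) : (apolar d ψ P).eval x = (apolar d ψ P).eval y := by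
  rw [eq_C_of_derivative_eq_zero (derivative_apolar hψ hP)]
  simp

theorem eval_iterate_derivative_X_sub_C_pow (n k : ℕ) (x : ℝ) :
    (derivative^[k] ((X - C x) ^ n)).eval x = if k = n then (n.factorial : ℝ) else 0 := by
  rw [iterate_derivative_X_sub_pow]
  split_ifs with h
  · subst h
    simp [Nat.descFactorial_self]
  · rcases lt_or_gt_of_ne h with h' | h'
    · simp [zero_pow (show n - k ≠ 0 by omega)]
    · simp [Nat.descFactorial_eq_zero_iff_lt.2 h']

/-- At x a single derivative of (X - x)^s survives, so the pairing reads off one derivative of P: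
its value for s = d, and the contact conditions for smaller s. -/
theorem eval_apolar_X_sub_C_pow (d s : ℕ) (hs : s ≤ d) (x : ℝ) (P : ℝ[X]) :
    (apolar d ((X - C x) ^ s) P).eval x =
      (-1) ^ (d - s) * (s.factorial * (derivative^[d - s] P).eval x) := by
  rw [apolar_apply, eval_finsetSum, Finset.sum_eq_single (d - s)]
  · rw [eval_smul, eval_mul, eval_iterate_derivative_X_sub_C_pow, if_pos (by omega), smul_eq_mul]
  · intro v hv hne
    have : v ≤ d := by simpa [Nat.lt_succ_iff] using hv
    rw [eval_smul, eval_mul, eval_iterate_derivative_X_sub_C_pow, if_neg (by omega)]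
    simp
  · intro h
    exact absurd (Finset.mem_range.2 (by omega)) h

theorem eval_iterate_derivative_eq_zero_of_dvd {P : ℝ[X]} {x : ℝ} {n k : ℕ}
    (h : (X - C x) ^ n ∣ P) (hk : k < n) : (derivative^[k] P).eval x = 0 := by
  have h₁ := pow_sub_dvd_iterate_derivative_of_pow_dvd k h
  obtain ⟨Q, hQ⟩ := h₁
  rw [hQ]
  simp [zero_pow (show n - k ≠ 0 by omega)]

/-- In the v-th term either d - v < M and the first factor vanishes at x, or v < d + 1 - M and the
second does. -/
theorem eval_apolar_eq_zero_of_dvd {d M : ℕ} {x : ℝ} {ψ P : ℝ[X]} (hψ : (X - C x) ^ M ∣ ψ)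
    (hP : (X - C x) ^ (d + 1 - M) ∣ P) : (apolar d ψ P).eval x = 0 := by
  rw [apolar_apply, eval_finsetSum]
  refine Finset.sum_eq_zero fun v hv => ?_
  have : v ≤ d := by simpa [Nat.lt_succ_iff] using hv
  rw [eval_smul, eval_mul]
  by_cases h : d - v < M
  · rw [eval_iterate_derivative_eq_zero_of_dvd hψ h]
    simp
  · rw [eval_iterate_derivative_eq_zero_of_dvd hP (show v < d + 1 - M by omega)]
    simp

/-- The term v = 0 contains the (d+1)-th derivative of ψ and drops out; the others are those of
degree d, shifted by one. -/
theorem apolar_succ {d : ℕ} {ψ : ℝ[X]} (hψ : ψ.natDegree ≤ d) (P : ℝ[X]) :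
    apolar (d + 1) ψ P = -apolar d ψ (derivative P) := by
  rw [apolar_apply, Finset.sum_range_succ', apolar_apply, ← Finset.sum_neg_distrib]
  have h₁ : derivative^[d + 1] ψ = 0 := iterate_derivative_eq_zero (by omega)
  simp only [Nat.sub_zero, h₁, zero_mul, smul_zero, add_zero]
  refine Finset.sum_congr rfl fun v _ => ?_
  rw [show d + 1 - (v + 1) = d - v by omega, pow_succ, mul_neg_one, neg_smul,
    Function.iterate_succ_apply]

theorem X_sub_C_pow_dvd_of_iterate_derivative {P : ℝ[X]} {x : ℝ} {n : ℕ}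
    (h : ∀ v < n, (derivative^[v] P).eval x = 0) : (X - C x) ^ n ∣ P := by
  rcases n with _ | n
  · simp
  by_cases hP : P = 0
  · simp [hP]
  rw [← le_rootMultiplicity_iff hP]
  exact lt_rootMultiplicity_of_isRoot_iterate_derivative hP fun v hv => h v (by omega)

/-- The dual functional of `bspline K d k`, in terms of the polynomial pieces of a spline. -/
noncomputable def dual (K : ℕ → ℝ) (d k : ℕ) : ℝ[X] →ₗ[ℝ] ℝ :=
  (d.factorial : ℝ)⁻¹ • (leval 0 ∘ₗ apolar d (knotPoly K d k))

/-- The pairing is constant, so the base point 0 in `dual` may be replaced by whichever knot is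
convenient. -/
theorem dual_apply (K : ℕ → ℝ) (d k : ℕ) (P : ℝ[X]) (hP : P.natDegree ≤ d) (x : ℝ) :
    dual K d k P = (d.factorial : ℝ)⁻¹ * (apolar d (knotPoly K d k) P).eval x := by
  rw [eval_apolar_eq (natDegree_knotPoly K d k).le hP x 0]
  simp [dual, leval]

/-- Pairing P with (X - x)^d at x gives d!·P(x); Marsden's identity expands the left argument into
knot polynomials. -/
theorem eq_sum_dual {K : ℕ → ℝ} (hK : Monotone K) {d m N : ℕ} (hd : d ≤ m)
    (hm : K m < K (m + 1)) (hN : m < N) {P : ℝ[X]} (hP : P.natDegree ≤ d) :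
    P = ∑ k ∈ Finset.range N, C (dual K d k P) * piece K d k m := by
  refine Polynomial.funext fun x => ?_
  have h₁ := eval_apolar_X_sub_C_pow d d le_rfl x P
  rw [← marsden hK hd hm hN x] at h₁
  have hd0 : (d.factorial : ℝ) ≠ 0 := by positivity
  rw [eval_finsetSum]
  simp only [eval_mul, eval_C, dual_apply K d _ P hP x]
  simp only [map_sum, LinearMap.sum_apply, eval_finsetSum, C_mul', map_smul,
    LinearMap.smul_apply, eval_smul, smul_eq_mul, Nat.sub_self, pow_zero, one_mul,
    Function.iterate_zero, id] at h₁
  rw [← mul_right_inj' hd0, ← h₁, Finset.mul_sum]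
  refine Finset.sum_congr rfl fun k _ => ?_
  field_simp

/-- By `eq_sum_dual` the d + 1 functionals active on the interval are jointly injective on
polynomials of degree at most d, hence bijective by dimension. The polynomial with value 1 under the
j-th and 0 under the others must be `piece K d j m`, again by `eq_sum_dual`. -/
theorem dual_piece {K : ℕ → ℝ} (hK : Monotone K) {d m k : ℕ} (hd : d ≤ m)
    (hm : K m < K (m + 1)) (hk : k ≤ m) (hk' : m ≤ k + d) (j : ℕ) :
    dual K d k (piece K d j m) = if j = k then 1 else 0 := by
  by_cases hj : j ≤ m ∧ m ≤ j + d
  swap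
  · have hz : piece K d j m = 0 := by
      by_contra h
      exact hj (le_of_piece_ne_zero h)
    rw [hz, map_zero, if_neg]
    rintro rfl
    exact hj ⟨hk, hk'⟩
  set Φ : degreeLT ℝ (d + 1) →ₗ[ℝ] (Fin (d + 1) → ℝ) :=
    (LinearMap.pi fun i : Fin (d + 1) => dual K d (m - d + i)) ∘ₗ (degreeLT ℝ (d + 1)).subtype
    with hΦ
  have hdeg : ∀ P : degreeLT ℝ (d + 1), (P : ℝ[X]).natDegree ≤ d := fun P => by
    have := mem_degreeLT.1 P.2
    exact natDegree_le_iff_coeff_eq_zero.2 fun N hN => (degree_lt_iff_coeff_zero _ _).1 this N hN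
  have hinj : Function.Injective Φ := by
    rw [injective_iff_map_eq_zero]
    intro P hP
    apply Subtype.ext
    rw [eq_sum_dual hK hd hm (Nat.lt_succ_self m) (hdeg P)]
    refine Finset.sum_eq_zero fun i _ => ?_
    by_cases hz : piece K d i m = 0
    · rw [hz, mul_zero]
    · obtain ⟨h₁, h₂⟩ := le_of_piece_ne_zero hz
      have := congrFun hP ⟨i - (m - d), by omega⟩
      simp only [hΦ, LinearMap.comp_apply, LinearMap.pi_apply, Submodule.subtype_apply,
        Pi.zero_apply, show m - d + (i - (m - d)) = i by omega] at this
      rw [this, C_0, zero_mul]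
  have hfin : Module.finrank ℝ (degreeLT ℝ (d + 1)) = Module.finrank ℝ (Fin (d + 1) → ℝ) :=
    (degreeLTEquiv ℝ (d + 1)).finrank_eq
  have : FiniteDimensional ℝ (degreeLT ℝ (d + 1)) :=
    Module.Finite.equiv (degreeLTEquiv ℝ (d + 1)).symm
  obtain ⟨P, hP⟩ := (LinearMap.injective_iff_surjective_of_finrank_eq_finrank hfin).1 hinj
    (fun i => if m - d + i = j then 1 else 0)
  have hPk : ∀ i, i ≤ m → m ≤ i + d → dual K d i P = if i = j then 1 else 0 := by
    intro i h₁ h₂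
    have := congrFun hP ⟨i - (m - d), by omega⟩
    simpa only [hΦ, LinearMap.comp_apply, LinearMap.pi_apply, Submodule.subtype_apply,
      show m - d + (i - (m - d)) = i by omega] using this
  have hPj : (P : ℝ[X]) = piece K d j m := by
    rw [eq_sum_dual hK hd hm (Nat.lt_succ_self m) (hdeg P), Finset.sum_eq_single j]
    · rw [hPk j hj.1 hj.2, if_pos rfl, C_1, one_mul]
    · intro i _ hi
      by_cases hz : piece K d i m = 0
      · rw [hz, mul_zero]
      · obtain ⟨h₁, h₂⟩ := le_of_piece_ne_zero hz
        rw [hPk i h₁ h₂, if_neg hi, C_0, zero_mul]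
    · intro h
      exact absurd (Finset.mem_range.2 (by omega)) h
  rw [← hPj, hPk k hk hk']
  simp only [eq_comm]

/-! ### Dual functionals and the order of contact at a knot. -/

theorem knotPoly_add (K : ℕ → ℝ) (a b k : ℕ) :
    knotPoly K (a + b) k = knotPoly K a k * knotPoly K b (k + a) := by
  rw [knotPoly, Finset.prod_range_add, knotPoly, knotPoly]
  simp only [add_assoc]

theorem knotPoly_congr {K T : ℕ → ℝ} {d k l : ℕ}
    (h : ∀ r < d, K (k + r + 1) = T (l + r + 1)) : knotPoly K d k = knotPoly T d l :=
  Finset.prod_congr rfl fun r hr => by rw [h r (Finset.mem_range.1 hr)]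

theorem knotPoly_eq_pow {K : ℕ → ℝ} {x : ℝ} {d k : ℕ}
    (h : ∀ r < d, K (k + r + 1) = x) : knotPoly K d k = (X - C x) ^ d := by
  rw [knotPoly, Finset.prod_congr rfl fun r hr => by rw [h r (Finset.mem_range.1 hr)]]
  simp

/-- The part of `knotPoly` that belongs to a knot `x = K (m + 1) = ⋯ = K m'`. -/
theorem knotPoly_split {K : ℕ → ℝ} {d k m m' : ℕ} {x : ℝ} (hmm : m ≤ m')
    (hx : ∀ j, m < j → j ≤ m' → K j = x) (hk : k ≤ m) (hk' : m' ≤ k + d) :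
    knotPoly K d k =
      knotPoly K (m - k) k * (X - C x) ^ (m' - m) * knotPoly K (k + d - m') m' := by
  conv_lhs => rw [show d = (m - k) + (m' - m) + (k + d - m') by omega]
  rw [knotPoly_add, knotPoly_add, show k + (m - k) = m by omega,
    show k + (m - k + (m' - m)) = m' by omega, knotPoly_eq_pow (x := x) (d := m' - m)]
  intro r hr
  exact hx _ (by omega) (by omega)

/-- The polynomials `knotPoly T D k`, `s ≤ k ≤ s + D`, span the polynomials of degree at most `D`
if `T i ≠ T j` for `s < i ≤ s + D < j ≤ s + 2 * D`. -/
theorem linearMap_eq_zero_of_knotPoly (L : ℝ[X] →ₗ[ℝ] ℝ) (T : ℕ → ℝ) (D s : ℕ)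
    (hT : ∀ i j, s < i → i ≤ s + D → s + D < j → j ≤ s + 2 * D → T i ≠ T j)
    (hL : ∀ k, s ≤ k → k ≤ s + D → L (knotPoly T D k) = 0) (Q : ℝ[X]) (hQ : Q.natDegree ≤ D) :
    L Q = 0 := by
  induction D generalizing s Q with
  | zero =>
    have := hL s le_rfl le_rfl
    rw [eq_C_of_natDegree_le_zero hQ, C_eq_algebraMap, Algebra.algebraMap_eq_smul_one, map_smul]
    simp only [knotPoly, Finset.range_zero, Finset.prod_empty] at this
    rw [this, smul_zero]
  | succ D ih =>
    have ih' := ih (s + 1) (fun i j h₁ h₂ h₃ h₄ => hT i j (by omega) (by omega) (by omega)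
      (by omega)) (by
        intro k h₁ h₂
        obtain ⟨k, rfl⟩ : ∃ l, k = l + 1 := ⟨k - 1, by omega⟩
        -- Neighbouring knot polynomials differ by a multiple of one of lower degree, and the
        -- separation `hT` makes the factor nonzero.
        have e : knotPoly T (D + 1) (k + 1) - knotPoly T (D + 1) k =
            (T (k + 1) - T (k + 1 + D + 1)) • knotPoly T D (k + 1) := by
          rw [knotPoly_succ, knotPoly_succ', smul_eq_C_mul, C_sub]
          ring
        have := congrArg L e
        rw [map_sub, hL _ (by omega) (by omega), hL _ (by omega) (by omega), map_smul, sub_zero,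
          smul_eq_mul, eq_comm, mul_eq_zero] at this
        exact this.resolve_left
          (sub_ne_zero.2 (hT _ _ (by omega) (by omega) (by omega) (by omega))))
    set c := Q.coeff (D + 1)
    -- One monic knot polynomial of full degree removes the leading term.
    have h₁ : (Q - c • knotPoly T (D + 1) s).natDegree ≤ D := by
      rw [natDegree_le_iff_coeff_eq_zero]
      intro N hN
      rcases (show D + 1 ≤ N from hN).eq_or_lt with rfl | hN'
      · have := (monic_knotPoly T (D + 1) s).coeff_natDegree
        rw [natDegree_knotPoly] at this
        simp [this, c]
      · rw [coeff_sub, coeff_smul, coeff_eq_zero_of_natDegree_lt (by omega),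
          coeff_eq_zero_of_natDegree_lt (by rw [natDegree_knotPoly]; omega)]
        simp
    have h₂ := ih' _ h₁
    rwa [map_sub, map_smul, hL s le_rfl (by omega), smul_zero, sub_zero] at h₂

/-- `x` lies in the closure of the knot intervals `[K m, K (m + 1))` from the left and
`[K m', K (m' + 1))` from the right. -/
structure Brackets (K : ℕ → ℝ) (x : ℝ) (m m' : ℕ) : Prop where
  left_lt : K m < x
  le_left : x ≤ K (m + 1)
  right_le : K m' ≤ x
  lt_right : x < K (m' + 1)

namespace Brackets

variable {K : ℕ → ℝ} {x : ℝ} {m m' : ℕ}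

theorem le (h : Brackets K x m m') (hK : Monotone K) : m ≤ m' := by
  have := hK.reflect_lt (h.left_lt.trans h.lt_right)
  omega

theorem eq_iff (h : Brackets K x m m') (hK : Monotone K) (j : ℕ) :
    K j = x ↔ m < j ∧ j ≤ m' := by
  constructor
  · rintro rfl
    have h₁ := hK.reflect_lt h.left_lt
    have h₂ := hK.reflect_lt h.lt_right
    omega
  · rintro ⟨h₁, h₂⟩
    exact le_antisymm ((hK h₂).trans h.right_le) (h.le_left.trans (hK h₁))

theorem left_nonempty (h : Brackets K x m m') : K m < K (m + 1) := h.left_lt.trans_le h.le_left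

theorem right_nonempty (h : Brackets K x m m') : K m' < K (m' + 1) :=
  h.right_le.trans_lt h.lt_right

end Brackets

/-- The knot polynomial of a straddling index contains all m' - m copies of x, so it supplies the
complementary power of X - x. -/
theorem Brackets.dual_eq_zero {K : ℕ → ℝ} {x : ℝ} {m m' : ℕ} (h : Brackets K x m m')
    (hK : Monotone K) {d k : ℕ} (hk : k ≤ m) (hk' : m' ≤ k + d) {Q : ℝ[X]}
    (hQ : Q.natDegree ≤ d) (hdvd : (X - C x) ^ (d + 1 - (m' - m)) ∣ Q) : dual K d k Q = 0 := by
  rw [dual_apply K d k Q hQ x, eval_apolar_eq_zero_of_dvd _ hdvd, mul_zero]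
  rw [knotPoly_split (h.le hK) (fun j h₁ h₂ => (h.eq_iff hK j).2 ⟨h₁, h₂⟩) hk hk']
  exact (dvd_mul_left _ _).mul_right _

/-- Once the common factor (X - x)^M is removed, the knot polynomials of the straddling indices span
all polynomials of degree at most d - M. Testing with powers of X - x then isolates the derivatives
of Q at x. -/
theorem Brackets.dvd_of_dual_eq_zero {K : ℕ → ℝ} {x : ℝ} {m m' : ℕ} (h : Brackets K x m m')
    (hK : Monotone K) {d : ℕ} (hd : d ≤ m') {Q : ℝ[X]} (hQ : Q.natDegree ≤ d)
    (hdual : ∀ k, k ≤ m → m' ≤ k + d → dual K d k Q = 0) :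
    (X - C x) ^ (d + 1 - (m' - m)) ∣ Q := by
  have hmm := h.le hK
  rcases lt_or_ge d (m' - m) with hlt | hge
  · simp [show d + 1 - (m' - m) = 0 by omega]
  set M := m' - m with hM
  set L : ℝ[X] →ₗ[ℝ] ℝ := leval x ∘ₗ (apolar d).flip Q ∘ₗ LinearMap.mulLeft ℝ ((X - C x) ^ M)
    with hL
  have hLapp : ∀ R, L R = (apolar d ((X - C x) ^ M * R) Q).eval x := fun R => by
    simp [hL, leval]
  -- `T` is `K` with the M copies of x deleted: its entries up to m lie left of x, the later ones
  -- right of x.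
  set T : ℕ → ℝ := fun j => if j ≤ m then K j else K (j + M) with hT
  have key : ∀ R : ℝ[X], R.natDegree ≤ d - M → L R = 0 := by
    intro R hR
    refine linearMap_eq_zero_of_knotPoly L T (d - M) (m' - d) ?_ ?_ R hR
    · intro i j h₁ h₂ h₃ h₄
      simp only [hT]
      rw [if_pos (by omega), if_neg (by omega)]
      exact ((hK (show i ≤ m by omega)).trans_lt
        ((h.left_lt.trans h.lt_right).trans_le (hK (show m' + 1 ≤ j + M by omega)))).ne
    · intro k h₁ h₂
      have h₃ : knotPoly T (d - M) k = knotPoly K (m - k) k * knotPoly K (k + d - m') m' := by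
        rw [show d - M = (m - k) + (k + d - m') by omega, knotPoly_add,
          show k + (m - k) = m by omega]
        congr 1
        · refine knotPoly_congr fun r hr => ?_
          simp only [hT]
          rw [if_pos (by omega)]
        · refine knotPoly_congr fun r hr => ?_
          simp only [hT]
          rw [if_neg (by omega), show m + r + 1 + M = m' + r + 1 by omega]
      have h₄ := hdual k (by omega) (by omega)
      rw [dual_apply K d k Q hQ x, mul_eq_zero] at h₄
      have h₅ := h₄.resolve_left (by positivity)
      rw [hLapp, h₃, ← h₅, knotPoly_split hmm (fun j h₁ h₂ => (h.eq_iff hK j).2 ⟨h₁, h₂⟩)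
        (show k ≤ m by omega) (show m' ≤ k + d by omega), ← hM]
      congr 3
      ring
  refine X_sub_C_pow_dvd_of_iterate_derivative fun v hv => ?_
  -- Together with the factor (X - x)^M the exponent is d - v, which singles out the v-th
  -- derivative.
  have h₁ := key ((X - C x) ^ (d - v - M)) (by
    rw [natDegree_pow, natDegree_X_sub_C]; omega)
  rw [hLapp, ← pow_add, eval_apolar_X_sub_C_pow _ _ (by omega),
    show d - (M + (d - v - M)) = v by omega] at h₁
  have h₂ : ((M + (d - v - M)).factorial : ℝ) ≠ 0 := by positivity
  simpa [h₂] using h₁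

theorem bspline_eq_zero_of_lt {K : ℕ → ℝ} (hK : Monotone K) {d i : ℕ} {x : ℝ} (h : x < K i) :
    bspline K d i x = 0 := by
  induction d generalizing i with
  | zero => simp [bspline, h]
  | succ d ih => simp [bspline, ih h, ih (h.trans_le (hK (Nat.le_succ i)))]

theorem bspline_eq_zero_of_le {K : ℕ → ℝ} (hK : Monotone K) {d i : ℕ} {x : ℝ}
    (h : K (i + d + 1) ≤ x) : bspline K d i x = 0 := by
  induction d generalizing i with
  | zero => simp only [bspline]; rw [if_neg]; exact fun h' => h'.2.not_ge h
  | succ d ih =>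
    simp only [bspline]
    rw [ih ((hK (by omega)).trans h), ih (by rwa [show i + 1 + d + 1 = i + (d + 1) + 1 by omega])]
    simp

theorem bspline_congr {K K' : ℕ → ℝ} {d i i' : ℕ} (h : ∀ j ≤ d + 1, K (i + j) = K' (i' + j)) :
    bspline K d i = bspline K' d i' := by
  induction d generalizing i i' with
  | zero =>
    funext x
    have h₀ := h 0 (by omega)
    have h₁ := h 1 (by omega)
    simp only [add_zero] at h₀
    simp only [bspline, h₀, h₁]
  | succ d ih =>
    funext x
    have h₀ := h 0 (by omega)
    have h₁ := h 1 (by omega)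
    have h₂ := h (d + 1) (by omega)
    have h₃ := h (d + 2) (by omega)
    simp only [add_zero, ← add_assoc] at h₀ h₂ h₃
    simp only [bspline, h₀, h₁, h₂, h₃]
    rw [ih (fun j hj => h j (by omega)), ih (i := i + 1) (i' := i' + 1) (fun j hj => by
      rw [add_assoc, add_assoc]; exact h (1 + j) (by omega))]

theorem Brackets.bspline_left {K : ℕ → ℝ} {x : ℝ} {m m' : ℕ} (h : Brackets K x m m')
    (hK : Monotone K) (d i : ℕ) : bspline K d i =ᶠ[𝓝[<] x] fun y => (piece K d i m).eval y := by
  filter_upwards [Ioo_mem_nhdsLT h.left_lt] with y hy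
  exact bspline_eq_piece hK hy.1.le (hy.2.trans_le h.le_left) d i

theorem Brackets.bspline_right {K : ℕ → ℝ} {x : ℝ} {m m' : ℕ} (h : Brackets K x m m')
    (hK : Monotone K) (d i : ℕ) : bspline K d i =ᶠ[𝓝[≥] x] fun y => (piece K d i m').eval y := by
  filter_upwards [Ico_mem_nhdsGE h.lt_right] with y hy
  exact bspline_eq_piece hK (h.right_le.trans hy.1) hy.2 d i

/-- The order of contact of the pieces of a B-spline at a knot. -/
theorem Brackets.dvd_piece_sub {K : ℕ → ℝ} {x : ℝ} {m m' : ℕ} (h : Brackets K x m m')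
    (hK : Monotone K) {d : ℕ} (hd : d ≤ m) (i : ℕ) :
    (X - C x) ^ (d + 1 - (m' - m)) ∣ piece K d i m' - piece K d i m := by
  have hmm := h.le hK
  refine h.dvd_of_dual_eq_zero hK (hd.trans hmm) ?_ ?_
  · exact (natDegree_sub_le _ _).trans
      (max_le (natDegree_piece_le _ _ _ _) (natDegree_piece_le _ _ _ _))
  -- A functional straddling x takes the same Kronecker value on both pieces, so it annihilates
  -- their difference.
  · intro k h₁ h₂
    rw [map_sub, dual_piece hK (hd.trans hmm) h.right_nonempty (h₁.trans hmm) h₂,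
      dual_piece hK hd h.left_nonempty h₁ (hmm.trans h₂), sub_self]

theorem exists_mem_Ico_knots {K : ℕ → ℝ} {s N : ℕ} {x : ℝ} (h₁ : K s ≤ x) (h₂ : x < K N)
    (hK : Monotone K) : ∃ m, s ≤ m ∧ m < N ∧ K m ≤ x ∧ x < K (m + 1) := by
  have hsN : s < N := hK.reflect_lt (h₁.trans_lt h₂)
  induction N with
  | zero => omega
  | succ N ih =>
    by_cases h : K N ≤ x
    · exact ⟨N, by omega, by omega, h, h₂⟩
    · push Not at h
      obtain ⟨m, h₃, h₄, h₅⟩ := ih h (hK.reflect_lt (h₁.trans_lt h))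
      exact ⟨m, h₃, by omega, h₅⟩

theorem exists_mem_Ioc_knots {K : ℕ → ℝ} {s N : ℕ} {x : ℝ} (h₁ : K s < x) (h₂ : x ≤ K N)
    (hK : Monotone K) : ∃ m, s ≤ m ∧ m < N ∧ K m < x ∧ x ≤ K (m + 1) := by
  have hsN : s < N := hK.reflect_lt (h₁.trans_le h₂)
  induction N with
  | zero => omega
  | succ N ih =>
    by_cases h : K N < x
    · exact ⟨N, by omega, by omega, h, h₂⟩
    · push Not at h
      obtain ⟨m, h₃, h₄, h₅⟩ := ih h (hK.reflect_lt (h₁.trans_le h))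
      exact ⟨m, h₃, by omega, h₅⟩

theorem exists_brackets {K : ℕ → ℝ} (hK : Monotone K) {s N : ℕ} {x : ℝ} (h₁ : K s < x)
    (h₂ : x < K N) : ∃ m m', s ≤ m ∧ m ≤ m' ∧ m' < N ∧ Brackets K x m m' := by
  obtain ⟨m, h₃, -, h₄, h₅⟩ := exists_mem_Ioc_knots h₁ h₂.le hK
  obtain ⟨m', -, h₆, h₇, h₈⟩ := exists_mem_Ico_knots h₁.le h₂ hK
  have h : Brackets K x m m' := ⟨h₄, h₅, h₇, h₈⟩
  exact ⟨m, m', h₃, h.le hK, h₆, h⟩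

/-! ### Splines as piecewise polynomials, and their products. -/

/-- `f` is a piecewise polynomial function of degree at most `d`, continuous from the right, whose
pieces left and right of `x` have contact of order `d + 1 - M x` at `x`. -/
def IsSpline (d : ℕ) (M : ℝ → ℕ) (f : ℝ → ℝ) : Prop :=
  ∀ x, ∃ P Q : ℝ[X], P.natDegree ≤ d ∧ Q.natDegree ≤ d ∧ (f =ᶠ[𝓝[<] x] fun y => P.eval y) ∧
    (f =ᶠ[𝓝[≥] x] fun y => Q.eval y) ∧ (X - C x) ^ (d + 1 - M x) ∣ Q - P

theorem eq_zero_of_X_sub_C_pow_dvd {D : ℝ[X]} {x : ℝ} {d : ℕ} (hD : D.natDegree ≤ d)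
    (h : (X - C x) ^ (d + 1) ∣ D) : D = 0 := by
  by_contra h0
  have := natDegree_le_of_dvd h h0
  rw [natDegree_pow, natDegree_X_sub_C] at this
  omega

/-- The jump is QQ' - PP' = (Q - P)Q' + P(Q' - P'). A factor of multiplicity 0 at x has no jump
there, hence only positive multiplicities impose a condition. -/
theorem IsSpline.mul {d e : ℕ} {M M' M'' : ℝ → ℕ} {f g : ℝ → ℝ} (hf : IsSpline d M f)
    (hg : IsSpline e M' g) (h : ∀ x, 0 < M x → e + M x ≤ M'' x)
    (h' : ∀ x, 0 < M' x → d + M' x ≤ M'' x) : IsSpline (d + e) M'' (fun x => f x * g x) := by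
  intro x
  obtain ⟨P, Q, hP, hQ, hfl, hfr, hdvd⟩ := hf x
  obtain ⟨P', Q', hP', hQ', hgl, hgr, hdvd'⟩ := hg x
  refine ⟨P * P', Q * Q', natDegree_mul_le_of_le hP hP', natDegree_mul_le_of_le hQ hQ', ?_, ?_, ?_⟩
  · filter_upwards [hfl, hgl] with y h₁ h₂
    rw [h₁, h₂, eval_mul]
  · filter_upwards [hfr, hgr] with y h₁ h₂
    rw [h₁, h₂, eval_mul]
  · rw [show Q * Q' - P * P' = (Q - P) * Q' + P * (Q' - P') by ring]
    refine dvd_add (Dvd.dvd.mul_right ?_ _) (Dvd.dvd.mul_left ?_ _)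
    · rcases Nat.eq_zero_or_pos (M x) with h0 | hpos
      · rw [h0] at hdvd
        rw [eq_zero_of_X_sub_C_pow_dvd
          ((natDegree_sub_le _ _).trans (max_le hQ hP)) hdvd]
        exact dvd_zero _
      · have := h x hpos
        exact (pow_dvd_pow _ (by omega)).trans hdvd
    · rcases Nat.eq_zero_or_pos (M' x) with h0 | hpos
      · rw [h0] at hdvd'
        rw [eq_zero_of_X_sub_C_pow_dvd
          ((natDegree_sub_le _ _).trans (max_le hQ' hP')) hdvd']
        exact dvd_zero _
      · have := h' x hpos
        exact (pow_dvd_pow _ (by omega)).trans hdvd'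

theorem polynomial_eq_of_eqOn_Ioo {P Q : ℝ[X]} {a b : ℝ} (hab : a < b)
    (h : ∀ x ∈ Ioo a b, P.eval x = Q.eval x) : P = Q :=
  eq_of_infinite_eval_eq P Q ((Ioo_infinite hab).mono h)

theorem polynomial_eq_of_eventually_nhdsGT {P Q : ℝ[X]} {x : ℝ}
    (h : ∀ᶠ y in 𝓝[>] x, P.eval y = Q.eval y) : P = Q := by
  obtain ⟨u, hu, hsub⟩ := mem_nhdsGT_iff_exists_Ioo_subset.1 h
  exact polynomial_eq_of_eqOn_Ioo hu fun y hy => hsub hy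

theorem polynomial_eq_of_eventually_nhdsLT {P Q : ℝ[X]} {x : ℝ}
    (h : ∀ᶠ y in 𝓝[<] x, P.eval y = Q.eval y) : P = Q := by
  obtain ⟨u, hu, hsub⟩ := mem_nhdsLT_iff_exists_Ioo_subset.1 h
  exact polynomial_eq_of_eqOn_Ioo hu fun y hy => hsub hy

/-- At the infimum of the points of disagreement the local polynomial equals `Q` on the left, hence
everywhere, so agreement extends past the infimum. -/
theorem eqOn_Ico_of_locally_polynomial {f : ℝ → ℝ} {a b : ℝ} {Q : ℝ[X]}
    (ha : f =ᶠ[𝓝[≥] a] fun y => Q.eval y)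
    (h : ∀ x ∈ Ioo a b, ∃ P : ℝ[X], f =ᶠ[𝓝 x] fun y => P.eval y) :
    ∀ x ∈ Ico a b, f x = Q.eval x := by
  by_contra! hcon
  obtain ⟨w, hw, hwne⟩ := hcon
  set s := {x | x ∈ Ico a b ∧ f x ≠ Q.eval x} with hs
  have hsne : s.Nonempty := ⟨w, hw, hwne⟩
  have hsb : BddBelow s := ⟨a, fun x hx => hx.1.1⟩
  set c := sInf s with hc
  have hcw : c ≤ w := csInf_le hsb ⟨hw, hwne⟩
  have hlt : ∀ y, a ≤ y → y < c → f y = Q.eval y := by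
    intro y h₁ h₂
    by_contra hne
    exact h₂.not_ge (csInf_le hsb ⟨⟨h₁, h₂.trans_le hcw |>.trans hw.2⟩, hne⟩)
  obtain ⟨u, hu, hQu⟩ := mem_nhdsGE_iff_exists_Ico_subset.1 ha
  have hac : a < c := by
    refine lt_of_lt_of_le hu (le_csInf hsne fun x hx => ?_)
    by_contra! hxu
    exact hx.2 (hQu ⟨hx.1.1, hxu⟩)
  obtain ⟨P, hP⟩ := h c ⟨hac, hcw.trans_lt hw.2⟩
  obtain ⟨l, r, hlr, hsub⟩ := mem_nhds_iff_exists_Ioo_subset.1 hP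
  have hPQ : P = Q := by
    refine polynomial_eq_of_eqOn_Ioo (max_lt hac hlr.1) fun y hy => ?_
    have h₁ : f y = P.eval y := hsub ⟨(le_max_right _ _).trans_lt hy.1, hy.2.trans hlr.2⟩
    rw [← h₁]
    exact hlt y ((le_max_left _ _).trans hy.1.le) hy.2
  have : r ≤ c := le_csInf hsne fun x hx => by
    by_contra! hxr
    have hcx : c ≤ x := csInf_le hsb hx
    have h₁ : f x = P.eval x := hsub ⟨hlr.1.trans_le hcx, hxr⟩
    exact hx.2 (hPQ ▸ h₁)
  exact this.not_gt hlr.2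

/-! ### Padded knot vectors and the Curry–Schoenberg theorem. -/

/-- Coefficients of a piecewise polynomial function with the right contact at the knots. -/
theorem exists_dual_eq {K : ℕ → ℝ} (hK : Monotone K) {d : ℕ} (P : ℕ → ℝ[X])
    (hdeg : ∀ m, (P m).natDegree ≤ d)
    (hP : ∀ x m m', Brackets K x m m' → (X - C x) ^ (d + 1 - (m' - m)) ∣ P m' - P m) :
    ∃ c : ℕ → ℝ, ∀ k m, k ≤ m → m ≤ k + d → K m < K (m + 1) → dual K d k (P m) = c k := by
  have key : ∀ k m₁ m₂, k ≤ m₁ → m₁ ≤ m₂ → m₂ ≤ k + d → K m₁ < K (m₁ + 1) → K m₂ < K (m₂ + 1) →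
      dual K d k (P m₂) = dual K d k (P m₁) := by
    intro k m₁ m₂ h₁
    induction m₂ using Nat.strong_induction_on with
    -- Strong induction, because the nonempty interval preceding `m₂` may be several indices away.
    -- Crossing the knot between them does not change the functional.
    | _ m₂ ih =>
      intro h₂ h₃ h₄ h₅
      rcases h₂.eq_or_lt with rfl | hlt
      · rfl
      obtain ⟨m, h₆, h₇, h₈, h₉⟩ :=
        exists_mem_Ioc_knots (h₄.trans_le (hK (show m₁ + 1 ≤ m₂ from hlt))) le_rfl hK
      have hB : Brackets K (K m₂) m m₂ := ⟨h₈, h₉, le_rfl, h₅⟩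
      have h := hB.dual_eq_zero hK (h₁.trans h₆) h₃
        ((natDegree_sub_le _ _).trans (max_le (hdeg m₂) (hdeg m))) (hP _ _ _ hB)
      rw [map_sub, sub_eq_zero] at h
      rw [h]
      exact ih m h₇ h₆ (by omega) h₄ hB.left_nonempty
  classical
  -- An index whose support contains no nonempty interval is unconstrained and gets the default 0.
  refine ⟨fun k => if h : ∃ m, k ≤ m ∧ m ≤ k + d ∧ K m < K (m + 1) then
    dual K d k (P h.choose) else 0, fun k m h₁ h₂ h₃ => ?_⟩
  have h : ∃ m, k ≤ m ∧ m ≤ k + d ∧ K m < K (m + 1) := ⟨m, h₁, h₂, h₃⟩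
  dsimp only
  rw [dif_pos h]
  obtain ⟨h₄, h₅, h₆⟩ := h.choose_spec
  rcases le_total m h.choose with hle | hle
  · exact (key k _ _ h₁ hle h₅ h₃ h₆).symm
  · exact key k _ _ h₄ hle h₂ h₆ h₃

/-- The knots `K 0, …, K L`, preceded by `s` simple knots and followed by infinitely many. -/
noncomputable def pad (K : ℕ → ℝ) (s L j : ℕ) : ℝ :=
  if j < s then K 0 - ((s : ℝ) - j) else if j ≤ s + L then K (j - s) else K L + ((j : ℝ) - (s + L))

section pad

variable {K : ℕ → ℝ} {s L : ℕ}

theorem pad_add {j : ℕ} (hj : j ≤ L) : pad K s L (j + s) = K j := by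
  rw [pad, if_neg (by omega), if_pos (by omega), Nat.add_sub_cancel]

theorem pad_of_lt {j : ℕ} (hj : j < s) : pad K s L j = K 0 - ((s : ℝ) - j) := if_pos hj

theorem pad_of_gt {j : ℕ} (hj : s + L < j) : pad K s L j = K L + ((j : ℝ) - (s + L)) := by
  rw [pad, if_neg (by omega), if_neg (by omega)]

theorem pad_lt_of_lt {j : ℕ} (hj : j < s) : pad K s L j < K 0 := by
  rw [pad_of_lt hj]
  have : (j : ℝ) < s := by exact_mod_cast hj
  linarith

theorem lt_pad_of_gt {j : ℕ} (hj : s + L < j) : K L < pad K s L j := by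
  rw [pad_of_gt hj]
  have : (s : ℝ) + L < j := by exact_mod_cast hj
  linarith

theorem pad_lt_succ_left {j : ℕ} (hj : j < s) : pad K s L j < pad K s L (j + 1) := by
  rcases (show j + 1 ≤ s from hj).eq_or_lt with h | h
  · have := pad_add (K := K) (s := s) (Nat.zero_le L)
    rw [zero_add, ← h] at this
    rw [← h, this]
    exact pad_lt_of_lt (by omega)
  · rw [pad_of_lt hj, pad_of_lt h]
    push_cast
    linarith

theorem pad_lt_succ_right {j : ℕ} (hj : s + L ≤ j) : pad K s L j < pad K s L (j + 1) := by
  rcases hj.eq_or_lt with h | h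
  · have := pad_add (K := K) (s := s) (le_refl L)
    rw [← h, add_comm s L, this]
    exact lt_pad_of_gt (by omega)
  · rw [pad_of_gt h, pad_of_gt (by omega)]
    push_cast
    linarith

theorem monotone_pad (hK : Monotone K) : Monotone (pad K s L) := by
  refine monotone_nat_of_le_succ fun j => ?_
  rcases lt_or_ge j s with h₁ | h₁
  · exact (pad_lt_succ_left h₁).le
  rcases lt_or_ge j (s + L) with h₂ | h₂
  · obtain ⟨j, rfl⟩ : ∃ i, j = i + s := ⟨j - s, by omega⟩
    rw [pad_add (by omega), show j + s + 1 = j + 1 + s by omega, pad_add (by omega)]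
    exact hK (Nat.le_succ j)
  · exact (pad_lt_succ_right h₂).le

theorem exists_lt_pad (x : ℝ) : ∃ N, s + L < N ∧ x < pad K s L N := by
  obtain ⟨N, hN⟩ := exists_nat_gt (x - K L)
  refine ⟨N + (s + L) + 1, by omega, ?_⟩
  rw [pad_of_gt (by omega)]
  push_cast
  linarith

theorem bspline_pad {d k : ℕ} (hk : k + d + 1 ≤ L) :
    bspline (pad K s L) d (k + s) = bspline K d k :=
  bspline_congr fun j hj => by
    rw [show k + s + j = k + j + s by omega, pad_add (by omega)]

end pad

/-- The multiplicity of `x` among the knots `K 0, …, K L`. -/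
noncomputable def knotCount (K : ℕ → ℝ) (L : ℕ) (x : ℝ) : ℕ :=
  ∑ j ∈ Finset.range (L + 1), if K j = x then 1 else 0

theorem knotCount_eq_card (K : ℕ → ℝ) (L : ℕ) (x : ℝ) :
    knotCount K L x = ((Finset.range (L + 1)).filter fun j => K j = x).card := by
  rw [knotCount, Finset.card_filter]

theorem Brackets.knotCount_le {K : ℕ → ℝ} {s L m m' : ℕ} {x : ℝ}
    (h : Brackets (pad K s L) x m m') (hK : Monotone K) : knotCount K L x ≤ m' - m := by
  rw [knotCount_eq_card, ← Nat.card_Ioc]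
  refine Finset.card_le_card_of_injOn (· + s) ?_ (fun a _ b _ hab => by simpa using hab)
  intro j hj
  simp only [Finset.coe_filter, Finset.mem_range, mem_ofPred_eq] at hj
  rw [Finset.coe_Ioc, mem_Ioc, ← h.eq_iff (monotone_pad hK), pad_add (by omega), hj.2]

theorem Brackets.le_knotCount {K : ℕ → ℝ} {s L m m' : ℕ} {x : ℝ}
    (h : Brackets (pad K s L) x m m') (hK : Monotone K) (h₀ : K 0 ≤ x) (hL : x ≤ K L) :
    m' - m ≤ knotCount K L x := by
  rw [knotCount_eq_card, ← Nat.card_Ioc]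
  have hmem : ∀ j ∈ Finset.Ioc m m', pad K s L j = x ∧ s ≤ j ∧ j ≤ s + L := by
    intro j hj
    have h₁ := (h.eq_iff (monotone_pad hK) j).2 (Finset.mem_Ioc.1 hj)
    refine ⟨h₁, ?_, ?_⟩
    · by_contra! h₂
      exact (pad_lt_of_lt (K := K) (L := L) h₂).not_ge (h₁ ▸ h₀)
    · by_contra! h₂
      exact (lt_pad_of_gt (K := K) h₂).not_ge (h₁ ▸ hL)
  refine Finset.card_le_card_of_injOn (· - s) ?_ ?_
  · intro j hj
    obtain ⟨h₁, h₂, h₃⟩ := hmem j hj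
    simp only [Finset.coe_filter, Finset.mem_range, mem_ofPred_eq]
    refine ⟨by omega, ?_⟩
    rw [← h₁, ← pad_add (K := K) (s := s) (L := L) (by omega), Nat.sub_add_cancel h₂]
  · intro a ha b hb hab
    have h₁ := hmem a ha
    have h₂ := hmem b hb
    simp only at hab
    omega

/-- The d + 1 padding knots give every interval meeting the original knots an index at least d, as
`Brackets.dvd_piece_sub` needs, even at the first knot. -/
theorem isSpline_bspline {K : ℕ → ℝ} (hK : Monotone K) {d i L : ℕ} (hL : i + d + 1 ≤ L) :
    IsSpline d (knotCount K L) (bspline K d i) := by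
  intro x
  rcases lt_or_ge x (K 0) with h₀ | h₀
  · have hz : ∀ y, y < K 0 → bspline K d i y = (0 : ℝ[X]).eval y := fun y hy => by
      rw [eval_zero, bspline_eq_zero_of_lt hK (hy.trans_le (hK (Nat.zero_le i)))]
    have : bspline K d i =ᶠ[𝓝 x] fun y => (0 : ℝ[X]).eval y := by
      filter_upwards [Iio_mem_nhds h₀] with y hy using hz y hy
    exact ⟨0, 0, by simp, by simp, this.filter_mono nhdsWithin_le_nhds,
      this.filter_mono nhdsWithin_le_nhds, by simp⟩
  rcases lt_or_ge (K L) x with h₁ | h₁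
  · have : bspline K d i =ᶠ[𝓝 x] fun y => (0 : ℝ[X]).eval y := by
      filter_upwards [Ioi_mem_nhds h₁] with y hy
      rw [eval_zero, bspline_eq_zero_of_le hK ((hK hL).trans (le_of_lt hy))]
    exact ⟨0, 0, by simp, by simp, this.filter_mono nhdsWithin_le_nhds,
      this.filter_mono nhdsWithin_le_nhds, by simp⟩
  obtain ⟨N, -, hN⟩ := exists_lt_pad (K := K) (s := d + 1) (L := L) x
  have hK' := monotone_pad (s := d + 1) (L := L) hK
  obtain ⟨m, m', h₂, h₃, -, hB⟩ := exists_brackets hK'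
    ((pad_lt_of_lt (K := K) (L := L) (Nat.lt_succ_self d)).trans_le h₀) hN
  rw [← bspline_pad (s := d + 1) hL]
  refine ⟨_, _, natDegree_piece_le _ _ _ _, natDegree_piece_le _ _ _ _, hB.bspline_left hK' d _,
    hB.bspline_right hK' d _, ?_⟩
  have := hB.le_knotCount hK h₀ h₁
  exact (pow_dvd_pow _ (by omega)).trans (hB.dvd_piece_sub hK' h₂ _)

theorem knotCount_pos_iff {K : ℕ → ℝ} {L : ℕ} {x : ℝ} :
    0 < knotCount K L x ↔ ∃ j ≤ L, K j = x := by
  rw [knotCount_eq_card, Finset.card_pos]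
  simp [Finset.Nonempty]

/-- The nontrivial half of the **Curry–Schoenberg theorem**: B-splines span the compactly supported
splines. -/
theorem IsSpline.exists_eq_sum {K : ℕ → ℝ} (hK : Monotone K) {d q : ℕ} {f : ℝ → ℝ}
    (hf : IsSpline d (knotCount K (q + d + 1)) f) (hf₀ : ∀ x < K 0, f x = 0)
    (hf₁ : ∀ x, K (q + d + 1) ≤ x → f x = 0) :
    ∃ c : ℕ → ℝ, ∀ x, f x = ∑ k ∈ Finset.range (q + 1), c k * bspline K d k x := by
  set L := q + d + 1 with hL
  set s := d + 1 with hs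
  set T := pad K s L with hT
  have hTm : Monotone T := monotone_pad hK
  choose A B hA hB hAl hBr hdvd using hf
  set P : ℕ → ℝ[X] := fun m => B (T m) with hP
  -- No knot lies inside the interval, so there is no jump and the right-hand piece at its start
  -- persists.
  have hP_eq : ∀ m, ∀ x ∈ Ico (T m) (T (m + 1)), f x = (P m).eval x := by
    intro m
    refine eqOn_Ico_of_locally_polynomial (hBr (T m)) fun x hx => ⟨B x, ?_⟩
    have hcount : knotCount K L x = 0 := by
      by_contra hne
      obtain ⟨j, hj, hjx⟩ := knotCount_pos_iff.1 (Nat.pos_of_ne_zero hne)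
      rw [← hjx, ← pad_add (K := K) (s := s) hj] at hx
      have h₁ := hTm.reflect_lt hx.1
      have h₂ := hTm.reflect_lt hx.2
      omega
    have h₁ := hdvd x
    rw [hcount] at h₁
    have h₂ := sub_eq_zero.1 (eq_zero_of_X_sub_C_pow_dvd
      ((natDegree_sub_le _ _).trans (max_le (hB x) (hA x))) h₁)
    have h₃ := hAl x
    rw [← h₂] at h₃
    rw [← nhdsLT_sup_nhdsGE]
    exact Filter.eventually_sup.2 ⟨h₃, hBr x⟩
  have hjump : ∀ x m m', Brackets T x m m' → (X - C x) ^ (d + 1 - (m' - m)) ∣ P m' - P m := by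
    intro x m m' h
    have h₁ : P m' = B x := by
      refine polynomial_eq_of_eventually_nhdsGT (x := x) ?_
      filter_upwards [nhdsWithin_mono x Ioi_subset_Ici_self (hBr x), Ioo_mem_nhdsGT h.lt_right]
        with y h₁ h₂
      rw [← hP_eq m' y ⟨h.right_le.trans h₂.1.le, h₂.2⟩, h₁]
    have h₂ : P m = A x := by
      refine polynomial_eq_of_eventually_nhdsLT (x := x) ?_
      filter_upwards [hAl x, Ioo_mem_nhdsLT h.left_lt] with y h₁ h₂
      rw [← hP_eq m y ⟨h₂.1.le, h₂.2.trans_le h.le_left⟩, h₁]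
    rw [h₁, h₂]
    have := h.knotCount_le hK
    exact (pow_dvd_pow _ (by omega)).trans (hdvd x)
  obtain ⟨c, hc⟩ := exists_dual_eq hTm P (fun m => hB _) hjump
  have hP0 : ∀ m, T m < T (m + 1) → (∀ x ∈ Ico (T m) (T (m + 1)), f x = 0) → P m = 0 := by
    intro m h₁ h₂
    refine polynomial_eq_of_eqOn_Ioo h₁ fun y hy => ?_
    rw [← hP_eq m y ⟨hy.1.le, hy.2⟩, h₂ y ⟨hy.1.le, hy.2⟩, eval_zero]
  -- The interval number d lies just left of `K 0`, where f vanishes, and belongs to the index range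
  -- of each of these functionals.
  have hcl : ∀ k < s, c k = 0 := by
    intro k hk
    have h₁ : T d < T (d + 1) := pad_lt_succ_left (Nat.lt_succ_self d)
    rw [← hc k d (by omega) (by omega) h₁, hP0 d h₁ fun x hx => hf₀ x ?_, map_zero]
    have h₂ := pad_add (K := K) (s := s) (Nat.zero_le L)
    rw [zero_add] at h₂
    rw [← h₂]
    exact hx.2
  -- Symmetrically, such an index still reaches the interval `max k (s + L)`, which lies right of
  -- the last original knot.
  have hcr : ∀ k, q + s < k → c k = 0 := by
    intro k hk
    have h₁ : T (max k (s + L)) < T (max k (s + L) + 1) := pad_lt_succ_right (le_max_right _ _)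
    rw [← hc k _ (le_max_left _ _) (max_le (by omega) (by omega)) h₁,
      hP0 _ h₁ fun x hx => hf₁ x ?_, map_zero]
    have h₂ := pad_add (K := K) (s := s) (le_refl L)
    rw [← h₂]
    exact (hTm (by omega : L + s ≤ max k (s + L))).trans hx.1
  refine ⟨fun k => c (k + s), fun x => ?_⟩
  rcases lt_or_ge x (T d) with hx | hx
  · have h₁ : x < K 0 := hx.trans (pad_lt_of_lt (Nat.lt_succ_self d))
    rw [hf₀ x h₁, Finset.sum_eq_zero fun k _ => ?_]
    rw [bspline_eq_zero_of_lt hK (h₁.trans_le (hK (Nat.zero_le k))), mul_zero]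
  obtain ⟨N, -, hN⟩ := exists_lt_pad (K := K) (s := s) (L := L) x
  obtain ⟨m, h₁, -, h₂, h₃⟩ := exists_mem_Ico_knots hx hN hTm
  set R := max (m + 1) (q + 1 + s) with hR
  have h₄ : f x = ∑ k ∈ Finset.range R, c k * bspline T d k x := by
    rw [hP_eq m x ⟨h₂, h₃⟩, eq_sum_dual hTm h₁ (h₂.trans_lt h₃)
      (show m < R from (Nat.lt_succ_self m).trans_le (le_max_left _ _))
      (show (P m).natDegree ≤ d from hB (T m)), eval_finsetSum]
    refine Finset.sum_congr rfl fun k _ => ?_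
    rw [eval_mul, eval_C, bspline_eq_piece hTm h₂ h₃]
    by_cases hz : piece T d k m = 0
    · simp [hz]
    · obtain ⟨h₅, h₆⟩ := le_of_piece_ne_zero hz
      rw [← hc k m h₅ h₆ (h₂.trans_lt h₃)]
  rw [h₄, ← Finset.sum_subset (Finset.range_mono (le_max_right (m + 1) (q + 1 + s)))
    (fun k _ hk => by rw [hcr k (by simp at hk; omega), zero_mul]), add_comm (q + 1) s,
    Finset.sum_range_add, Finset.sum_eq_zero (fun k hk => by
      rw [hcl k (Finset.mem_range.1 hk), zero_mul]), zero_add]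
  refine Finset.sum_congr rfl fun k hk => ?_
  have := Finset.mem_range.1 hk
  rw [add_comm s k, bspline_pad (by omega)]

/-! ### The right end point, product expansions and the partition of unity. -/

theorem basisOn_of_ne {b x : ℝ} (hx : x ≠ b) (K : ℕ → ℝ) (d i : ℕ) :
    basisOn b K d i x = bspline K d i x :=
  Function.update_of_ne hx _ _

theorem tendsto_bspline_basisOn {K : ℕ → ℝ} (hK : Monotone K) (b : ℝ) (d i : ℕ) :
    Tendsto (bspline K d i) (𝓝[<] b) (𝓝 (basisOn b K d i b)) := by
  obtain ⟨P, -, -, -, hP, -, -⟩ := isSpline_bspline hK (le_refl (i + d + 1)) b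
  have h : Tendsto (bspline K d i) (𝓝[<] b) (𝓝 (P.eval b)) :=
    (P.continuous.continuousWithinAt).congr' hP.symm
  rw [basisOn, Function.update_self, leftLim_eq_of_tendsto h]
  exact h

theorem basisOn_eq_piece {K : ℕ → ℝ} (hK : Monotone K) {b : ℝ} {m : ℕ} (h₁ : K m < b)
    (h₂ : b ≤ K (m + 1)) (d i : ℕ) {x : ℝ} (hx : x ∈ Icc (K m) b) :
    basisOn b K d i x = (piece K d i m).eval x := by
  rcases hx.2.eq_or_lt with rfl | hlt
  · refine tendsto_nhds_unique (tendsto_bspline_basisOn hK x d i)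
      ((piece K d i m).continuous.continuousWithinAt.congr' ?_)
    filter_upwards [Ioo_mem_nhdsLT h₁] with y hy
    exact (bspline_eq_piece hK hy.1.le (hy.2.trans_le h₂) d i).symm
  · rw [basisOn_of_ne hlt.ne]
    exact bspline_eq_piece hK hx.1 (hlt.trans_le h₂) d i

/-- Only the point b needs an argument: there both sides are limits from the left of the identity
for `bspline`. -/
theorem isExpansion_mul {K K' T : ℕ → ℝ} (hK : Monotone K) (hK' : Monotone K') (hT : Monotone T)
    {d e D i j q : ℕ} {c : ℕ → ℝ} (b : ℝ)
    (h : ∀ x, bspline K d i x * bspline K' e j x =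
      ∑ k ∈ Finset.range (q + 1), c k * bspline T D k x) :
    IsExpansion b T D q c fun x => basisOn b K d i x * basisOn b K' e j x := by
  intro x
  rcases eq_or_ne x b with rfl | hx
  · refine tendsto_nhds_unique
      ((tendsto_bspline_basisOn hK x d i).mul (tendsto_bspline_basisOn hK' x e j)) ?_
    simp only [h]
    exact tendsto_finsetSum _ fun k _ => (tendsto_bspline_basisOn hT x D k).const_mul (c k)
  · simp only [basisOn_of_ne hx, h]

/-- Products of B-splines are combinations of the B-splines over a knot vector with sufficiently
large multiplicities. -/
theorem exists_isExpansion_mul {K K' T : ℕ → ℝ} (hK : Monotone K) (hK' : Monotone K')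
    (hT : Monotone T) {d e D i j q L L' : ℕ} (hD : D = d + e) (hi : i + d + 1 ≤ L)
    (hj : j + e + 1 ≤ L') (h₀ : T 0 ≤ K 0) (h₁ : K L ≤ T (q + D + 1))
    (h : ∀ x, 0 < knotCount K L x → e + knotCount K L x ≤ knotCount T (q + D + 1) x)
    (h' : ∀ x, 0 < knotCount K' L' x → d + knotCount K' L' x ≤ knotCount T (q + D + 1) x)
    (b : ℝ) :
    ∃ c, IsExpansion b T D q c fun x => basisOn b K d i x * basisOn b K' e j x := by
  subst hD
  have hf := (isSpline_bspline hK hi).mul (isSpline_bspline hK' hj) h h'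
  obtain ⟨c, hc⟩ := hf.exists_eq_sum hT
    (fun x hx => by
      rw [bspline_eq_zero_of_lt hK ((hx.trans_le h₀).trans_le (hK (Nat.zero_le i))), zero_mul])
    (fun x hx => by
      rw [bspline_eq_zero_of_le hK (((hK hi).trans h₁).trans hx), zero_mul])
  exact ⟨c, isExpansion_mul hK hK' hT b hc⟩

/-- Compare the coefficients of X^d in Marsden's identity; all knot polynomials are monic. -/
theorem sum_piece_eq_one {K : ℕ → ℝ} (hK : Monotone K) {d m N : ℕ} (hd : d ≤ m)
    (hm : K m < K (m + 1)) (hN : m < N) (x : ℝ) :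
    ∑ k ∈ Finset.range N, (piece K d k m).eval x = 1 := by
  have h := congrArg (fun P : ℝ[X] => P.coeff d) (marsden hK hd hm hN x)
  have hmon : ∀ P : ℝ[X], P.Monic → P.natDegree = d → P.coeff d = 1 := fun P h₁ h₂ => by
    rw [← h₂]; exact h₁
  simp only [finsetSum_coeff, coeff_C_mul] at h
  rw [hmon _ ((monic_X_sub_C x).pow d) (by rw [natDegree_pow, natDegree_X_sub_C, mul_one])] at h
  rw [← h]
  refine Finset.sum_congr rfl fun k _ => ?_
  rw [hmon _ (monic_knotPoly K d k) (natDegree_knotPoly K d k), mul_one]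

theorem sum_basisOn_eq_one {K : ℕ → ℝ} (hK : Monotone K) {d N : ℕ} {b x : ℝ} (h₁ : K d ≤ x)
    (hb : b ≤ K N) (hdb : K d < b) (hx : x ≤ b) :
    ∑ k ∈ Finset.range N, basisOn b K d k x = 1 := by
  rcases hx.eq_or_lt with rfl | hlt
  · obtain ⟨m, h₂, h₃, h₄, h₅⟩ := exists_mem_Ioc_knots hdb hb hK
    simp only [basisOn_eq_piece hK h₄ h₅ d _ (right_mem_Icc.2 h₄.le)]
    exact sum_piece_eq_one hK h₂ (h₄.trans_le h₅) h₃ x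
  · obtain ⟨m, h₂, h₃, h₄, h₅⟩ := exists_mem_Ico_knots h₁ (hlt.trans_le hb) hK
    simp only [basisOn_of_ne hlt.ne, bspline_eq_piece hK h₄ h₅]
    exact sum_piece_eq_one hK h₂ (h₄.trans_lt h₅) h₃ x

/-! ### Integration of B-splines. -/

theorem measurable_bspline (K : ℕ → ℝ) (d i : ℕ) : Measurable (bspline K d i) := by
  induction d generalizing i with
  | zero =>
    have : bspline K 0 i = fun x => if x ∈ Ico (K i) (K (i + 1)) then 1 else 0 := rfl
    rw [this]
    exact Measurable.ite measurableSet_Ico measurable_const measurable_const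
  | succ d ih =>
    have h₁ := ih i
    have h₂ := ih (i + 1)
    have : bspline K (d + 1) i = fun x =>
        (x - K i) / (K (i + d + 1) - K i) * bspline K d i x
          + (K (i + d + 2) - x) / (K (i + d + 2) - K (i + 1)) * bspline K d (i + 1) x := rfl
    rw [this]
    fun_prop

/-- A crude bound, sufficient for integrability: on the support both recursion weights lie in [0,
1]. -/
theorem abs_bspline_le {K : ℕ → ℝ} (hK : Monotone K) (d i : ℕ) (x : ℝ) :
    |bspline K d i x| ≤ 2 ^ d := by
  induction d generalizing i with
  | zero => simp only [bspline]; split_ifs <;> simp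
  | succ d ih =>
    have key : ∀ j c, (bspline K d j x ≠ 0 → |c| ≤ 1) → |c * bspline K d j x| ≤ 2 ^ d := by
      intro j c hc
      by_cases h : bspline K d j x = 0
      · simp [h]
      · rw [abs_mul]
        exact (mul_le_of_le_one_left (abs_nonneg _) (hc h)).trans (ih j)
    have hsupp : ∀ j, bspline K d j x ≠ 0 → K j ≤ x ∧ x < K (j + d + 1) := by
      intro j hj
      constructor
      · by_contra! h
        exact hj (bspline_eq_zero_of_lt hK h)
      · by_contra! h
        exact hj (bspline_eq_zero_of_le hK h)
    have h₁ := key i ((x - K i) / (K (i + d + 1) - K i)) fun hne => by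
      obtain ⟨h₂, h₃⟩ := hsupp i hne
      rw [abs_of_nonneg (div_nonneg (by linarith) (by linarith))]
      exact div_le_one_of_le₀ (by linarith) (by linarith)
    have h₂ := key (i + 1) ((K (i + d + 2) - x) / (K (i + d + 2) - K (i + 1))) fun hne => by
      obtain ⟨h₂, h₃⟩ := hsupp (i + 1) hne
      rw [show i + 1 + d + 1 = i + d + 2 by omega] at h₃
      rw [abs_of_nonneg (div_nonneg (by linarith) (by linarith))]
      exact div_le_one_of_le₀ (by linarith) (by linarith)
    simp only [bspline]
    refine (abs_add_le _ _).trans ?_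
    rw [pow_succ]
    linarith

theorem intervalIntegrable_bspline {K : ℕ → ℝ} (hK : Monotone K) (d i : ℕ) (a b : ℝ) :
    IntervalIntegrable (bspline K d i) volume a b :=
  (intervalIntegrable_const (c := (2 : ℝ) ^ d)).mono_fun'
    (measurable_bspline K d i).aestronglyMeasurable
    (Eventually.of_forall fun x => abs_bspline_le hK d i x)

theorem intervalIntegrable_bspline_mul {K K' : ℕ → ℝ} (hK : Monotone K) (hK' : Monotone K')
    (d i e j : ℕ) (a b : ℝ) :
    IntervalIntegrable (fun x => bspline K d i x * bspline K' e j x) volume a b :=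
  (intervalIntegrable_const (c := (2 : ℝ) ^ d * 2 ^ e)).mono_fun'
    ((measurable_bspline K d i).mul (measurable_bspline K' e j)).aestronglyMeasurable
    (Eventually.of_forall fun x => by
      dsimp only
      rw [norm_mul]
      exact mul_le_mul (abs_bspline_le hK d i x) (abs_bspline_le hK' e j x) (norm_nonneg _)
        (by positivity))

section integral

variable {K : ℕ → ℝ} {d j N : ℕ}

theorem dual_sum_piece (hK : Monotone K) {m k : ℕ} (hd : d ≤ m) (hm : K m < K (m + 1))
    (hk : k ≤ m) (hk' : m ≤ k + d) (hN : m < N) :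
    dual K d k (∑ i ∈ Finset.Ico j N, piece K d i m) = if j ≤ k then 1 else 0 := by
  simp only [map_sum, dual_piece hK hd hm hk hk', Finset.sum_ite_eq', Finset.mem_Ico,
    (show k < N by omega), and_true]

theorem natDegree_sum_piece_le (m : ℕ) :
    (∑ i ∈ Finset.Ico j N, piece K d i m).natDegree ≤ d :=
  natDegree_sum_le_of_forall_le _ _ fun i _ => natDegree_piece_le K d i m

/-- The difference of neighbouring knot polynomials drops one degree, and `apolar_succ` trades that
degree for a derivative of P. -/
theorem dual_derivative (K : ℕ → ℝ) (d k : ℕ) {P : ℝ[X]} (hP : P.natDegree ≤ d + 1) :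
    (K (k + d + 2) - K (k + 1)) * dual K d (k + 1) (derivative P) =
      (d + 1) * (dual K (d + 1) (k + 1) P - dual K (d + 1) k P) := by
  have hP' : (derivative P).natDegree ≤ d := (natDegree_derivative_le P).trans (by omega)
  have e : knotPoly K (d + 1) (k + 1) - knotPoly K (d + 1) k =
      (K (k + 1) - K (k + d + 2)) • knotPoly K d (k + 1) := by
    rw [knotPoly_succ, knotPoly_succ', smul_eq_C_mul, C_sub,
      show k + 1 + d + 1 = k + d + 2 by omega]
    ring
  have h := congrArg (fun ψ => (apolar (d + 1) ψ P).eval 0) e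
  simp only [map_sub, map_smul, LinearMap.sub_apply, LinearMap.smul_apply, eval_sub, eval_smul,
    smul_eq_mul, apolar_succ (natDegree_knotPoly K d (k + 1)).le P, eval_neg] at h
  rw [dual_apply K _ _ _ hP' 0, dual_apply K _ _ _ hP 0, dual_apply K _ _ _ hP 0, ← mul_sub, h,
    Nat.factorial_succ]
  push_cast
  have : (d.factorial : ℝ) ≠ 0 := by positivity
  have : (d : ℝ) + 1 ≠ 0 := by positivity
  field_simp
  ring

/-- The tail sum has coefficients 0 before j and 1 from j on. Differentiation takes differences of
coefficients, so only index j remains. -/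
theorem derivative_sum_piece (hK : Monotone K) {m : ℕ} (hd : d + 1 ≤ m) (hm : K m < K (m + 1))
    (hN : m < N) (hj : K j < K (j + d + 1)) :
    derivative (∑ i ∈ Finset.Ico j N, piece K (d + 1) i m) =
      C ((d + 1) / (K (j + d + 1) - K j)) * piece K d j m := by
  set A := ∑ i ∈ Finset.Ico j N, piece K (d + 1) i m with hA
  have hAdeg : A.natDegree ≤ d + 1 := natDegree_sum_piece_le m
  rw [eq_sum_dual hK (show d ≤ m by omega) hm hN
    ((natDegree_derivative_le A).trans (by omega) : (derivative A).natDegree ≤ d)]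
  have hterm : ∀ k, C (dual K d k (derivative A)) * piece K d k m =
      if j = k then C ((d + 1) / (K (j + d + 1) - K j)) * piece K d j m else 0 := by
    intro k
    by_cases hz : piece K d k m = 0
    · rw [hz, mul_zero]
      split_ifs with h
      · rw [h, hz, mul_zero]
      · rfl
    obtain ⟨h₁, h₂⟩ := le_of_piece_ne_zero hz
    obtain ⟨k, rfl⟩ : ∃ l, k = l + 1 := ⟨k - 1, by omega⟩
    have h := dual_derivative K d k hAdeg
    rw [hA, dual_sum_piece hK hd hm h₁ (by omega) hN,
      dual_sum_piece hK hd hm (by omega) (by omega) hN, ← hA] at h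
    have hpos : 0 < K (k + d + 2) - K (k + 1) :=
      sub_pos.2 ((hK h₁).trans_lt (hm.trans_le (hK (by omega))))
    split_ifs with hjk
    · subst hjk
      rw [if_pos le_rfl, if_neg (by omega)] at h
      rw [show k + 1 + d + 1 = k + d + 2 by omega]
      congr 2
      rw [eq_div_iff hpos.ne', mul_comm, h]
      ring
    · have : (if j ≤ k + 1 then (1 : ℝ) else 0) - (if j ≤ k then 1 else 0) = 0 := by
        by_cases h' : j ≤ k
        · rw [if_pos h', if_pos (by omega), sub_self]
        · rw [if_neg h', if_neg (by omega), sub_self]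
      rw [this, mul_zero, mul_eq_zero] at h
      rw [h.resolve_left hpos.ne', C_0, zero_mul]
  rw [Finset.sum_congr rfl fun k _ => hterm k, Finset.sum_ite_eq]
  split_ifs with h
  · rfl
  · rw [piece_eq_zero_of_lt K (by simp at h; omega), mul_zero]

theorem dual_of_knots_eq {x : ℝ} {k : ℕ} (hx : ∀ r < d, K (k + r + 1) = x) {P : ℝ[X]}
    (hP : P.natDegree ≤ d) : dual K d k P = P.eval x := by
  rw [dual_apply K d k P hP x, knotPoly_eq_pow hx, eval_apolar_X_sub_C_pow _ _ le_rfl]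
  have : (d.factorial : ℝ) ≠ 0 := by positivity
  simp [this]

/-- Single B-splines may jump at a knot of high multiplicity, but this tail sum does not. There the
one-sided values are coefficients 0 or 1, and a discrepancy would force `K j = K (j + d + 1)`. For
multiplicity at most d each piece is continuous. -/
theorem Brackets.eval_sum_piece_eq {x : ℝ} {m m' : ℕ} (h : Brackets K x m m') (hK : Monotone K)
    (hd : d + 1 ≤ m) (hN : m' < N) (hj : K j < K (j + d + 1)) :
    (∑ i ∈ Finset.Ico j N, piece K (d + 1) i m).eval x =
      (∑ i ∈ Finset.Ico j N, piece K (d + 1) i m').eval x := by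
  have hmm := h.le hK
  rcases lt_or_ge d (m' - m) with hlt | hge
  · rw [← dual_of_knots_eq (K := K) (k := m)
      (fun r hr => (h.eq_iff hK _).2 ⟨by omega, by omega⟩) (natDegree_sum_piece_le m),
      ← dual_of_knots_eq (K := K) (k := m' - (d + 1))
      (fun r hr => (h.eq_iff hK _).2 ⟨by omega, by omega⟩) (natDegree_sum_piece_le m'),
      dual_sum_piece hK hd h.left_nonempty le_rfl (by omega) (by omega),
      dual_sum_piece hK (by omega) h.right_nonempty (by omega) (by omega) hN]
    by_cases h₁ : j ≤ m
    · rw [if_pos h₁, if_pos (by omega)]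
    · rw [if_neg h₁, if_neg]
      intro h₂
      have h₃ := (h.eq_iff hK j).2 ⟨by omega, by omega⟩
      have h₄ := (h.eq_iff hK (j + d + 1)).2 ⟨by omega, by omega⟩
      exact hj.ne (h₃.trans h₄.symm)
  · rw [eq_comm, ← sub_eq_zero, ← eval_sub, ← Finset.sum_sub_distrib, eval_finsetSum]
    refine Finset.sum_eq_zero fun i _ => ?_
    have h₁ : (X - C x) ∣ piece K (d + 1) i m' - piece K (d + 1) i m :=
      (dvd_pow_self _ (by omega)).trans (h.dvd_piece_sub hK hd i)
    exact dvd_iff_isRoot.1 h₁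

theorem continuousOn_sum_basisOn (hK : Monotone K) {a b : ℝ} (hab : a < b) (ha : K (d + 1) ≤ a)
    (hb : b ≤ K N) (hj : K j < K (j + d + 1)) :
    ContinuousOn (fun x => ∑ i ∈ Finset.Ico j N, basisOn b K (d + 1) i x) (Icc a b) := by
  intro x hx
  have hpiece : ∀ m, (fun y => (∑ i ∈ Finset.Ico j N, piece K (d + 1) i m).eval y) =
      fun y => ∑ i ∈ Finset.Ico j N, (piece K (d + 1) i m).eval y := fun m => by
    funext y; rw [eval_finsetSum]
  have hcont : ∀ (m : ℕ) (s : Set ℝ), ContinuousWithinAt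
      (fun y => (∑ i ∈ Finset.Ico j N, piece K (d + 1) i m).eval y) s x := fun m s =>
    (Polynomial.continuous _).continuousWithinAt
  rcases hx.2.eq_or_lt with rfl | hxb
  · obtain ⟨m, h₁, h₂, h₃, h₄⟩ := exists_mem_Ioc_knots (ha.trans_lt hab) hb hK
    refine (hcont m _).congr_of_eventuallyEq_of_mem ?_ hx
    filter_upwards [self_mem_nhdsWithin, nhdsWithin_le_nhds (Ioi_mem_nhds h₃)] with y hy hy'
    rw [eval_finsetSum]
    exact Finset.sum_congr rfl fun i _ => basisOn_eq_piece hK h₃ h₄ _ _ ⟨le_of_lt hy', hy.2⟩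
  have hright : ∀ m', K m' ≤ x → x < K (m' + 1) →
      (fun x => ∑ i ∈ Finset.Ico j N, basisOn b K (d + 1) i x) =ᶠ[𝓝[≥] x]
        fun y => (∑ i ∈ Finset.Ico j N, piece K (d + 1) i m').eval y := by
    intro m' h₁ h₂
    filter_upwards [Ico_mem_nhdsGE (lt_min hxb h₂)] with y hy
    rw [eval_finsetSum]
    refine Finset.sum_congr rfl fun i _ => ?_
    rw [basisOn_of_ne (hy.2.trans_le (min_le_left _ _)).ne]
    exact bspline_eq_piece hK (h₁.trans hy.1) (hy.2.trans_le (min_le_right _ _)) _ _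
  rcases hx.1.eq_or_lt with rfl | hax
  · obtain ⟨m', h₁, h₂, h₃, h₄⟩ := exists_mem_Ico_knots ha (hxb.trans_le hb) hK
    exact ((hcont m' (Ici a)).congr_of_eventuallyEq_of_mem (hright m' h₃ h₄) self_mem_Ici).mono
      Icc_subset_Ici_self
  · obtain ⟨m, m', h₁, h₂, h₃, hB⟩ := exists_brackets hK (ha.trans_lt hax) (hxb.trans_le hb)
    refine ContinuousAt.continuousWithinAt ?_
    have hr := hright m' hB.right_le hB.lt_right
    rw [ContinuousAt, ← nhdsLT_sup_nhdsGE, tendsto_sup]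
    refine ⟨(hcont m (Iio x)).congr_of_eventuallyEq ?_ ?_,
      (hcont m' (Ici x)).congr_of_eventuallyEq_of_mem hr self_mem_Ici⟩
    · filter_upwards [Ioo_mem_nhdsLT hB.left_lt] with y hy
      rw [eval_finsetSum]
      refine Finset.sum_congr rfl fun i _ => ?_
      rw [basisOn_of_ne (hy.2.trans hxb).ne]
      exact bspline_eq_piece hK hy.1.le (hy.2.trans_le hB.le_left) _ _
    · rw [hB.eval_sum_piece_eq hK h₁ h₃ hj]
      exact hr.self_of_nhdsWithin self_mem_Ici

/-- Integrals of B-splines. -/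
theorem integral_bspline (hK : Monotone K) {a b x : ℝ} (hab : a < b) (ha : K (d + 1) ≤ a)
    (hb : b ≤ K N) (hx : x ∈ Icc a b) :
    ∫ y in a..x, bspline K d j y = (K (j + d + 1) - K j) / (d + 1) *
      ∑ i ∈ Finset.Ico j N, (basisOn b K (d + 1) i x - basisOn b K (d + 1) i a) := by
  -- For empty support both the B-spline and the prefactor vanish.
  rcases (hK (show j ≤ j + d + 1 by omega)).eq_or_lt with hj | hj
  · have hz : ∀ y, bspline K d j y = 0 := fun y => by
      rcases lt_or_ge y (K j) with h | h
      · exact bspline_eq_zero_of_lt hK h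
      · exact bspline_eq_zero_of_le hK (hj ▸ h)
    simp [hz, hj]
  set g : ℝ → ℝ := fun x => ∑ i ∈ Finset.Ico j N, basisOn b K (d + 1) i x with hg
  have hpos : 0 < K (j + d + 1) - K j := sub_pos.2 hj
  have hcont :=
    (continuousOn_sum_basisOn (j := j) hK hab ha hb hj).mono (Icc_subset_Icc_right hx.2)
  -- Right derivatives suffice for a continuous primitive, and on a right neighbourhood of y one
  -- polynomial piece describes the tail sum, even if y is a knot.
  have hderiv : ∀ y ∈ Ioo a x, HasDerivWithinAt g
      ((d + 1) / (K (j + d + 1) - K j) * bspline K d j y) (Ioi y) y := by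
    intro y hy
    have hyb : y < b := hy.2.trans_le hx.2
    obtain ⟨m, h₁, h₂, h₃, h₄⟩ := exists_mem_Ico_knots (ha.trans hy.1.le) (hyb.trans_le hb) hK
    have h₅ := (∑ i ∈ Finset.Ico j N, piece K (d + 1) i m).hasDerivAt y
    rw [derivative_sum_piece hK h₁ (h₃.trans_lt h₄) h₂ hj, eval_mul, eval_C,
      ← bspline_eq_piece hK h₃ h₄] at h₅
    have h₆ : ∀ u ∈ Ico y (min b (K (m + 1))),
        g u = (∑ i ∈ Finset.Ico j N, piece K (d + 1) i m).eval u := by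
      intro u hu
      rw [eval_finsetSum]
      refine Finset.sum_congr rfl fun i _ => ?_
      rw [basisOn_of_ne (hu.2.trans_le (min_le_left _ _)).ne]
      exact bspline_eq_piece hK (h₃.trans hu.1) (hu.2.trans_le (min_le_right _ _)) _ _
    have h₇ : y < min b (K (m + 1)) := lt_min hyb h₄
    refine h₅.hasDerivWithinAt.congr_of_eventuallyEq ?_ (h₆ y ⟨le_rfl, h₇⟩)
    filter_upwards [Ioo_mem_nhdsGT h₇] with u hu
    exact h₆ u ⟨hu.1.le, hu.2⟩
  have h := intervalIntegral.integral_eq_sub_of_hasDeriv_right_of_le hx.1 hcont hderiv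
    ((intervalIntegrable_bspline hK d j a x).const_mul _)
  rw [intervalIntegral.integral_const_mul] at h
  rw [Finset.sum_sub_distrib]
  change _ = _ * (g x - g a)
  rw [← h]
  have : (d : ℝ) + 1 ≠ 0 := by positivity
  field_simp

end integral

/-! ### Linear independence and Gram systems. -/

/-- **Linear independence** of B-splines with nondegenerate support. -/
theorem coeff_eq_zero_of_ae_eq_zero {K : ℕ → ℝ} (hK : Monotone K) {d q : ℕ}
    (hdeg : ∀ k ≤ q, K k < K (k + d + 1)) (c : ℕ → ℝ)
    (h : ∀ᵐ x ∂(volume.restrict (Ioc (K 0) (K (q + d + 1)))),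
      ∑ k ∈ Finset.range (q + 1), c k * bspline K d k x = 0) : ∀ k ≤ q, c k = 0 := by
  intro k hk
  obtain ⟨m, h₁, h₂, h₃, h₄⟩ := exists_mem_Ico_knots le_rfl (hdeg k hk) hK
  have hm : K m < K (m + 1) := h₃.trans_lt h₄
  -- Padding by d knots moves interval m to index m + d, where the dual functionals are available.
  set T := pad K d (q + d + 1) with hT
  have hTm : Monotone T := monotone_pad hK
  have e₁ : T (m + d) = K m := pad_add (by omega)
  have e₂ : T (m + d + 1) = K (m + 1) := by
    rw [show m + d + 1 = m + 1 + d by omega]; exact pad_add (by omega)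
  set Q : ℝ[X] := ∑ l ∈ Finset.range (q + 1), c l • piece T d (l + d) (m + d) with hQ
  have hQeq : ∀ x ∈ Ioo (K m) (K (m + 1)),
      ∑ l ∈ Finset.range (q + 1), c l * bspline K d l x = Q.eval x := by
    intro x hx
    rw [hQ, eval_finsetSum]
    refine Finset.sum_congr rfl fun l hl => ?_
    have := Finset.mem_range.1 hl
    rw [eval_smul, smul_eq_mul, ← bspline_eq_piece hTm (e₁.symm ▸ hx.1.le) (e₂.symm ▸ hx.2),
      bspline_pad (by omega)]
  have hsub : Ioo (K m) (K (m + 1)) ⊆ Ioc (K 0) (K (q + d + 1)) := fun x hx =>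
    ⟨(hK (Nat.zero_le m)).trans_lt hx.1, hx.2.le.trans (hK (by omega))⟩
  have hQ0 : Q = 0 := by
    refine polynomial_eq_of_eqOn_Ioo hm ?_
    -- Almost everywhere equality of polynomials on an open interval is equality by continuity.
    refine Measure.eqOn_Ioo_of_ae_eq (μ := volume) ?_ Q.continuous.continuousOn
      (0 : ℝ[X]).continuous.continuousOn
    filter_upwards [ae_restrict_of_ae_restrict_of_subset hsub h,
      ae_restrict_mem measurableSet_Ioo] with x hx hx'
    rw [← hQeq x hx', hx, eval_zero]
  have h₅ := congrArg (dual T d (k + d)) hQ0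
  simp only [hQ, map_sum, map_smul, map_zero, smul_eq_mul,
    dual_piece hTm (show d ≤ m + d by omega) (by rw [e₁, e₂]; exact hm)
      (show k + d ≤ m + d by omega) (by omega), add_left_inj, mul_ite, mul_one, mul_zero,
    Finset.sum_ite_eq', Finset.mem_range, if_pos (Nat.lt_succ_of_le hk)] at h₅
  exact h₅

theorem gram_mulVec {K : ℕ → ℝ} (hK : Monotone K) (d N : ℕ) (c : ℕ → ℝ) :
    (gram K d N).mulVec (fun k => c k) =
      moments K d N fun x => ∑ k ∈ Finset.range (N + 1), c k * bspline K d k x := by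
  funext l
  simp only [Matrix.mulVec, dotProduct, gram, Matrix.of_apply, moments]
  have : ∀ x, (∑ k ∈ Finset.range (N + 1), c k * bspline K d k x) * bspline K d l x =
      ∑ k ∈ Finset.range (N + 1), c k * (bspline K d l x * bspline K d k x) := fun x => by
    rw [Finset.sum_mul]
    exact Finset.sum_congr rfl fun k _ => by ring
  simp only [this]
  rw [intervalIntegral.integral_finsetSum fun k _ =>
    (intervalIntegrable_bspline_mul hK hK _ _ _ _ _ _).const_mul _, Finset.sum_range]
  refine Finset.sum_congr rfl fun k _ => ?_
  rw [intervalIntegral.integral_const_mul, mul_comm]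

theorem moments_congr (K : ℕ → ℝ) (d N : ℕ) {f g : ℝ → ℝ} (h : ∀ᵐ x, f x = g x) :
    moments K d N f = moments K d N g := by
  funext l
  refine intervalIntegral.integral_congr_ae ?_
  filter_upwards [h] with x hx _
  rw [hx]

theorem IsExpansion.moments_eq {K : ℕ → ℝ} (hK : Monotone K) {d N : ℕ} {b : ℝ} {c : ℕ → ℝ}
    {f : ℝ → ℝ} (h : IsExpansion b K d N c f) :
    (gram K d N).mulVec (fun k => c k) = moments K d N f := by
  rw [gram_mulVec hK]
  refine moments_congr K d N ?_
  filter_upwards [(countable_singleton b).ae_notMem volume] with x hx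
  rw [h x]
  exact Finset.sum_congr rfl fun k _ => by rw [basisOn_of_ne (by simpa using hx)]

/-- For a kernel vector, the quadratic form of the Gram matrix is the integral of the square of the
corresponding spline. The spline thus vanishes almost everywhere, and so do its coefficients. -/
theorem det_gram_ne_zero {K : ℕ → ℝ} (hK : Monotone K) {d q : ℕ}
    (hdeg : ∀ k ≤ q, K k < K (k + d + 1)) : (gram K d q).det ≠ 0 := by
  intro hdet
  obtain ⟨v, hv, hv0⟩ := Matrix.exists_mulVec_eq_zero_iff.2 hdet
  set c : ℕ → ℝ := fun k => if h : k < q + 1 then v ⟨k, h⟩ else 0 with hc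
  have hcv : (fun k : Fin (q + 1) => c k) = v := by
    funext k
    exact dif_pos k.2
  rw [← hcv, gram_mulVec hK] at hv0
  set G : ℝ → ℝ := fun x => ∑ k ∈ Finset.range (q + 1), c k * bspline K d k x with hG
  have hGint : ∀ k, IntervalIntegrable (fun x => G x * bspline K d k x) volume (K 0)
      (K (q + d + 1)) := by
    intro k
    have : (fun x => G x * bspline K d k x) = ∑ l ∈ Finset.range (q + 1),
        fun x => c l * (bspline K d l x * bspline K d k x) := by
      funext x
      simp only [hG, Finset.sum_mul, Finset.sum_apply, mul_assoc]
    rw [this]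
    exact IntervalIntegrable.sum _ fun l _ =>
      (intervalIntegrable_bspline_mul hK hK _ _ _ _ _ _).const_mul _
  have hGG : (fun x => G x * G x) = fun x => ∑ k ∈ Finset.range (q + 1),
      c k * (G x * bspline K d k x) := by
    funext x
    change G x * ∑ k ∈ Finset.range (q + 1), c k * bspline K d k x = _
    rw [Finset.mul_sum]
    exact Finset.sum_congr rfl fun k _ => by ring
  have hGGint : IntervalIntegrable (fun x => G x * G x) volume (K 0) (K (q + d + 1)) := by
    have : (fun x => G x * G x) = ∑ k ∈ Finset.range (q + 1),
        fun x => c k * (G x * bspline K d k x) := by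
      rw [hGG]
      funext x
      simp only [Finset.sum_apply]
    rw [this]
    exact IntervalIntegrable.sum _ fun k _ => (hGint k).const_mul _
  have hzero : ∫ x in (K 0)..(K (q + d + 1)), G x * G x = 0 := by
    rw [hGG, intervalIntegral.integral_finsetSum fun k _ => (hGint k).const_mul _]
    refine Finset.sum_eq_zero fun k hk => ?_
    have : ∫ x in (K 0)..(K (q + d + 1)), G x * bspline K d k x = 0 :=
      congrFun hv0 ⟨k, Finset.mem_range.1 hk⟩
    rw [intervalIntegral.integral_const_mul, this, mul_zero]
  have hle : K 0 ≤ K (q + d + 1) := hK (Nat.zero_le _)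
  rw [intervalIntegral.integral_eq_zero_iff_of_le_of_nonneg_ae hle
    (Eventually.of_forall fun x => mul_self_nonneg (G x)) hGGint] at hzero
  have hc0 := coeff_eq_zero_of_ae_eq_zero hK hdeg c (by
    filter_upwards [hzero] with x hx
    exact mul_self_eq_zero.1 hx)
  exact hv (by
    rw [← hcv]
    funext k
    exact hc0 k (Nat.lt_succ_iff.1 k.2))

/-- The Gram system characterizes the coefficients of a spline. -/
theorem gram_system {K : ℕ → ℝ} (hK : Monotone K) {d q : ℕ}
    (hdeg : ∀ k ≤ q, K k < K (k + d + 1)) {b : ℝ} {f : ℝ → ℝ}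
    (hf : ∃ c, IsExpansion b K d q c f) (c : ℕ → ℝ) :
    (gram K d q).mulVec (fun k => c k) = moments K d q f ↔ IsExpansion b K d q c f := by
  refine ⟨fun h => ?_, fun h => h.moments_eq hK⟩
  obtain ⟨c₀, hc₀⟩ := hf
  have h₁ := hc₀.moments_eq hK
  rw [← h₁] at h
  have h₂ : (fun k : Fin (q + 1) => c k) = fun k : Fin (q + 1) => c₀ k :=
    Matrix.mulVec_injective_iff_isUnit.2
      ((Matrix.isUnit_iff_isUnit_det _).2 (det_gram_ne_zero hK hdeg).isUnit) h
  intro x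
  rw [hc₀ x]
  refine Finset.sum_congr rfl fun k hk => ?_
  have := congrFun h₂ ⟨k, Finset.mem_range.1 hk⟩
  simp only at this
  rw [this]

/-! ### Consequences of compatible knot vectors: expansions and integrals. -/

/-- The properties of the knot vectors on which the results about PH B-spline curves rest. -/
structure Knots.Compatible (S : Knots) (n p : ℕ) (a b : ℝ) : Prop where
  monotone_μ : Monotone S.μ
  monotone_ν : Monotone S.ν
  monotone_ρ : Monotone S.ρ
  monotone_τ : Monotone S.τ
  ν_zero_le : S.ν 0 ≤ S.μ 0
  μ_last_le : S.μ (p + n + 1) ≤ S.ν (S.q + 2 * n + 1)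
  τ_zero_le : S.τ 0 ≤ S.ρ 0
  ρ_last_le : S.ρ (S.q + 1 + (2 * n + 1) + 1) ≤ S.τ (S.w + (4 * n + 1) + 1)
  count_μ_ν : ∀ x, 0 < knotCount S.μ (p + n + 1) x →
    n + knotCount S.μ (p + n + 1) x ≤ knotCount S.ν (S.q + 2 * n + 1) x
  count_ρ_τ : ∀ x, 0 < knotCount S.ρ (S.q + 1 + (2 * n + 1) + 1) x →
    2 * n + knotCount S.ρ (S.q + 1 + (2 * n + 1) + 1) x ≤
      knotCount S.τ (S.w + (4 * n + 1) + 1) x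
  count_ν_τ : ∀ x, 0 < knotCount S.ν (S.q + 2 * n + 1) x →
    2 * n + 1 + knotCount S.ν (S.q + 2 * n + 1) x ≤ knotCount S.τ (S.w + (4 * n + 1) + 1) x
  ρ_succ : ∀ j, S.ρ (j + 1) = S.ν j
  ρ_le : S.ρ (2 * n + 1) ≤ a
  le_ρ : b ≤ S.ρ (S.q + 2)

theorem intervalIntegrable_bspline_smul {K : ℕ → ℝ} (hK : Monotone K) (d i : ℕ) (a b : ℝ)
    {E : Type*} [NormedAddCommGroup E] [NormedSpace ℝ E] (v : E) :
    IntervalIntegrable (fun x => bspline K d i x • v) volume a b :=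
  ⟨Integrable.smul_const (intervalIntegrable_bspline hK d i a b).1 v,
    Integrable.smul_const (intervalIntegrable_bspline hK d i a b).2 v⟩

theorem arcCoeff_eq_sum (n : ℕ) (ν σ : ℕ → ℝ) (i : ℕ) :
    arcCoeff n ν σ i =
      ∑ j ∈ Finset.range i, ((ν (j + 2 * n + 1) - ν j) / (2 * n + 1)) • σ j := by
  induction i with
  | zero => simp [arcCoeff]
  | succ i ih => rw [arcCoeff, Finset.sum_range_succ, ih, smul_eq_mul]

theorem curveCoeff_eq_sum (n : ℕ) (ν : ℕ → ℝ) (P : ℕ → ℂ) (r₀ : ℂ) (i : ℕ) :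
    curveCoeff n ν P r₀ i =
      r₀ + ∑ j ∈ Finset.range i, ((ν (j + 2 * n + 1) - ν j) / (2 * n + 1)) • P j := by
  induction i with
  | zero => simp [curveCoeff]
  | succ i ih => rw [curveCoeff, Finset.sum_range_succ, ih, Complex.real_smul, add_assoc]

/-- Values in a module allow the same rearrangement for real weights and for complex control points.
-/
theorem sum_smul_eq_of_expansion {E : Type*} [AddCommGroup E] [Module ℝ E] {I J N : ℕ}
    {f : ℕ → ℕ → ℝ} {c : ℕ → ℕ → ℕ → ℝ} {B : ℕ → ℝ}
    (h : ∀ i < I, ∀ j < J, f i j = ∑ k ∈ Finset.range N, c i j k * B k) (A : ℕ → ℕ → E) :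
    ∑ i ∈ Finset.range I, ∑ j ∈ Finset.range J, f i j • A i j =
      ∑ k ∈ Finset.range N, B k • ∑ i ∈ Finset.range I, ∑ j ∈ Finset.range J, c i j k • A i j := by
  symm
  simp only [Finset.smul_sum]
  rw [Finset.sum_comm' (t' := Finset.range I) (s' := fun _ => Finset.range N) (by simp)]
  refine Finset.sum_congr rfl fun i hi => ?_
  rw [Finset.sum_comm' (t' := Finset.range J) (s' := fun _ => Finset.range N) (by simp)]
  refine Finset.sum_congr rfl fun j hj => ?_
  rw [h i (Finset.mem_range.1 hi) j (Finset.mem_range.1 hj), Finset.sum_smul]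
  exact Finset.sum_congr rfl fun k _ => by rw [mul_comm, mul_smul]

namespace Knots.Compatible

variable {S : Knots} {n p : ℕ} {a b : ℝ}

theorem exists_isChi (hS : S.Compatible n p a b) (b' : ℝ) : ∃ χ, S.IsChi n p b' χ := by
  have h : ∀ i j, ∃ c : ℕ → ℝ, i ≤ p → j ≤ p → IsExpansion b' S.ν (2 * n) S.q c
      fun x => basisOn b' S.μ n i x * basisOn b' S.μ n j x := by
    intro i j
    by_cases hij : i ≤ p ∧ j ≤ p
    · obtain ⟨c, hc⟩ := exists_isExpansion_mul hS.monotone_μ hS.monotone_μ hS.monotone_ν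
        (D := 2 * n) (two_mul n) (show i + n + 1 ≤ p + n + 1 by omega)
        (show j + n + 1 ≤ p + n + 1 by omega) hS.ν_zero_le hS.μ_last_le hS.count_μ_ν hS.count_μ_ν b'
      exact ⟨c, fun _ _ => hc⟩
    · exact ⟨0, fun h₁ h₂ => absurd ⟨h₁, h₂⟩ hij⟩
  choose c hc using h
  -- Coefficients need not be unique for degenerate bases, so symmetry is imposed by choosing one
  -- expansion per unordered pair.
  refine ⟨fun i j => c (min i j) (max i j), ⟨fun i _ j _ k _ => ?_, fun i hi j hj => ?_⟩⟩
  · simp only [min_comm i j, max_comm i j]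
  · have h := hc (min i j) (max i j) (by omega) (by omega)
    rcases le_total i j with hij | hij
    · simpa only [min_eq_left hij, max_eq_right hij] using h
    · simp only [min_eq_right hij, max_eq_left hij] at h ⊢
      intro x
      exact (mul_comm _ _).trans (h x)

theorem exists_expansion_τ (hS : S.Compatible n p a b) (b' : ℝ) {i j : ℕ} (hi : i ≤ S.q + 1)
    (hj : j ≤ S.q) : ∃ c, IsExpansion b' S.τ (4 * n + 1) S.w c
      fun x => basisOn b' S.ρ (2 * n + 1) i x * basisOn b' S.ν (2 * n) j x :=
  exists_isExpansion_mul hS.monotone_ρ hS.monotone_ν hS.monotone_τ (D := 4 * n + 1) (by omega)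
    (show i + (2 * n + 1) + 1 ≤ S.q + 1 + (2 * n + 1) + 1 by omega)
    (show j + 2 * n + 1 ≤ S.q + 2 * n + 1 by omega) hS.τ_zero_le hS.ρ_last_le hS.count_ρ_τ
    hS.count_ν_τ b'

theorem exists_isZeta (hS : S.Compatible n p a b) (b' : ℝ) : ∃ ζ, S.IsZeta n b' ζ := by
  have h : ∀ i j, ∃ c : ℕ → ℝ, i ≤ S.q + 1 → j ≤ S.q → IsExpansion b' S.τ (4 * n + 1) S.w c
      fun x => basisOn b' S.ρ (2 * n + 1) i x * basisOn b' S.ν (2 * n) j x := by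
    intro i j
    by_cases hij : i ≤ S.q + 1 ∧ j ≤ S.q
    · obtain ⟨c, hc⟩ := hS.exists_expansion_τ b' hij.1 hij.2
      exact ⟨c, fun _ _ => hc⟩
    · exact ⟨0, fun h₁ h₂ => absurd ⟨h₁, h₂⟩ hij⟩
  choose c hc using h
  exact ⟨c, fun i hi j hj => hc i j hi hj⟩

/-- Exchanging the sums collects at index i the contributions of all j < i; these partial sums are
the recursions for `arcCoeff` (real `v`) and `curveCoeff` (complex `v`). -/
theorem integral_sum_basisOn (hS : S.Compatible n p a b) (hab : a < b) {E : Type*}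
    [NormedAddCommGroup E] [NormedSpace ℝ E] [CompleteSpace E] (v : ℕ → E) {x : ℝ}
    (hx : x ∈ Icc a b) :
    ∫ y in a..x, ∑ k ∈ Finset.range (S.q + 1), basisOn b S.ν (2 * n) k y • v k =
      ∑ i ∈ Finset.range (S.q + 2),
        (basisOn b S.ρ (2 * n + 1) i x - basisOn b S.ρ (2 * n + 1) i a) •
          ∑ j ∈ Finset.range i, ((S.ν (j + 2 * n + 1) - S.ν j) / (2 * n + 1)) • v j := by
  -- Prepending one knot turns `ν` into `ρ`, so the basis index shifts by one.
  have hbs : ∀ k, bspline S.ν (2 * n) k = bspline S.ρ (2 * n) (k + 1) := fun k =>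
    bspline_congr fun j _ => by rw [← hS.ρ_succ, show k + 1 + j = k + j + 1 by omega]
  have hint : ∀ k, IntervalIntegrable (fun y => bspline S.ν (2 * n) k y • v k) volume a x :=
    fun k => intervalIntegrable_bspline_smul hS.monotone_ν (2 * n) k a x (v k)
  have hk : ∀ k, ∫ y in a..x, bspline S.ν (2 * n) k y =
      (S.ν (k + 2 * n + 1) - S.ν k) / (2 * n + 1) * ∑ i ∈ Finset.Ico (k + 1) (S.q + 2),
        (basisOn b S.ρ (2 * n + 1) i x - basisOn b S.ρ (2 * n + 1) i a) := by
    intro k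
    rw [hbs k, integral_bspline hS.monotone_ρ hab hS.ρ_le hS.le_ρ hx, ← hS.ρ_succ, ← hS.ρ_succ,
      show k + 2 * n + 1 + 1 = k + 1 + 2 * n + 1 by omega]
    push_cast
    rfl
  have hcongr : ∫ y in a..x, ∑ k ∈ Finset.range (S.q + 1), basisOn b S.ν (2 * n) k y • v k =
      ∫ y in a..x, ∑ k ∈ Finset.range (S.q + 1), bspline S.ν (2 * n) k y • v k := by
    refine intervalIntegral.integral_congr_ae ?_
    filter_upwards [(countable_singleton b).ae_notMem volume] with y hy _
    exact Finset.sum_congr rfl fun k _ => by rw [basisOn_of_ne (by simpa using hy)]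
  rw [hcongr, intervalIntegral.integral_finsetSum fun k _ => hint k]
  simp only [intervalIntegral.integral_smul_const, hk, Finset.mul_sum, Finset.sum_smul,
    Finset.smul_sum]
  rw [Finset.sum_comm' (t' := Finset.range (S.q + 2)) (s' := fun i => Finset.range i)
    (by intro x y; simp only [Finset.mem_range, Finset.mem_Ico]; omega)]
  refine Finset.sum_congr rfl fun i _ => Finset.sum_congr rfl fun j _ => ?_
  rw [smul_smul, mul_comm]

theorem intervalIntegrable_sum_basisOn (hS : S.Compatible n p a b) {E : Type*}
    [NormedAddCommGroup E] [NormedSpace ℝ E] (v : ℕ → E) (x : ℝ) :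
    IntervalIntegrable
      (fun y => ∑ k ∈ Finset.range (S.q + 1), basisOn b S.ν (2 * n) k y • v k) volume a x := by
  have h : IntervalIntegrable (∑ k ∈ Finset.range (S.q + 1),
      fun y => bspline S.ν (2 * n) k y • v k) volume a x :=
    IntervalIntegrable.sum _ fun k _ =>
      intervalIntegrable_bspline_smul hS.monotone_ν (2 * n) k a x (v k)
  refine h.congr_ae (ae_restrict_of_ae ?_)
  filter_upwards [(countable_singleton b).ae_notMem volume] with y hy
  rw [Finset.sum_apply]
  exact Finset.sum_congr rfl fun k _ => by rw [basisOn_of_ne (by simpa using hy)]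

end Knots.Compatible

/-! ### PH curves: speed, arc length, control points and offsets. -/

section curve

variable {S : Knots} {n p : ℕ} {a b : ℝ} {χ : ℕ → ℕ → ℕ → ℝ}

/-- Two coefficient sequences are allowed because it is used with z, z for the hodograph and with z,
conj z for the speed. -/
theorem Knots.IsChi.sum_mul_sum (hχ : S.IsChi n p b χ) (u v : ℕ → ℂ) (x : ℝ) :
    (∑ i ∈ Finset.range (p + 1), u i * (basisOn b S.μ n i x : ℂ)) *
        ∑ j ∈ Finset.range (p + 1), v j * (basisOn b S.μ n j x : ℂ) =
      ∑ k ∈ Finset.range (S.q + 1), basisOn b S.ν (2 * n) k x •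
        ∑ i ∈ Finset.range (p + 1), ∑ j ∈ Finset.range (p + 1), (χ i j k : ℂ) * u i * v j := by
  have h := sum_smul_eq_of_expansion (I := p + 1) (J := p + 1)
    (f := fun i j => basisOn b S.μ n i x * basisOn b S.μ n j x)
    (fun i hi j hj => hχ.expand i (by omega) j (by omega) x) (fun i j => u i * v j)
  simp only [Complex.real_smul, Complex.ofReal_mul] at h ⊢
  simp only [mul_assoc]
  rw [← h, Finset.sum_mul_sum]
  exact Finset.sum_congr rfl fun i _ => Finset.sum_congr rfl fun j _ => by ring

theorem Knots.IsChi.preimage_sq (hχ : S.IsChi n p b χ) (z : ℕ → ℂ) (x : ℝ) :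
    preimage n p b S.μ z x ^ 2 =
      ∑ k ∈ Finset.range (S.q + 1), basisOn b S.ν (2 * n) k x • hodoCoeff p χ z k := by
  rw [sq, preimage, hχ.sum_mul_sum]
  rfl

theorem Knots.IsChi.norm_preimage_sq (hχ : S.IsChi n p b χ) (z : ℕ → ℂ) (x : ℝ) :
    ‖preimage n p b S.μ z x‖ ^ 2 =
      ∑ k ∈ Finset.range (S.q + 1), basisOn b S.ν (2 * n) k x • speedCoeff p χ z k := by
  have h := hχ.sum_mul_sum z (fun j => (starRingEnd ℂ) (z j)) x
  have hconj : ∑ j ∈ Finset.range (p + 1), (starRingEnd ℂ) (z j) * (basisOn b S.μ n j x : ℂ) =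
      (starRingEnd ℂ) (preimage n p b S.μ z x) := by
    simp [preimage]
  rw [hconj] at h
  change preimage n p b S.μ z x * _ = _ at h
  rw [Complex.mul_conj'] at h
  have h' : ((‖preimage n p b S.μ z x‖ ^ 2 : ℝ) : ℂ) =
      ((∑ k ∈ Finset.range (S.q + 1), basisOn b S.ν (2 * n) k x • speedCoeff p χ z k : ℝ) : ℂ) := by
    rw [Complex.ofReal_pow, h, Complex.ofReal_sum]
    refine Finset.sum_congr rfl fun k hk => ?_
    rw [smul_eq_mul, Complex.ofReal_mul, speedCoeff_eq S n p b χ hχ z k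
      (by simpa [Nat.lt_succ_iff] using hk), Complex.real_smul]
  exact_mod_cast h'

variable {z : ℕ → ℂ} {r : ℝ → ℂ}

theorem IsRegularPH.derivWithin_eq (hr : IsRegularPH n p a b S.μ z r) (hab : a < b) {x : ℝ}
    (hx : x ∈ Icc a b) : derivWithin r (Icc a b) x = preimage n p b S.μ z x ^ 2 :=
  (hr.hodograph x hx).derivWithin (uniqueDiffOn_Icc hab x hx)

theorem IsRegularPH.speed_eq (hr : IsRegularPH n p a b S.μ z r) (hχ : S.IsChi n p b χ)
    (hab : a < b) {x : ℝ} (hx : x ∈ Icc a b) : speed a b r x =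
      ∑ k ∈ Finset.range (S.q + 1), basisOn b S.ν (2 * n) k x • speedCoeff p χ z k := by
  rw [speed, hr.derivWithin_eq hab hx, norm_pow, hχ.norm_preimage_sq]

theorem IsRegularPH.speed_pos (hr : IsRegularPH n p a b S.μ z r) (hab : a < b) {x : ℝ}
    (hx : x ∈ Icc a b) : 0 < speed a b r x := by
  rw [speed, hr.derivWithin_eq hab hx]
  exact norm_pos_iff.2 (pow_ne_zero 2 (hr.regular x hx))

theorem IsRegularPH.integral_speed (hr : IsRegularPH n p a b S.μ z r) (hχ : S.IsChi n p b χ)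
    (hS : S.Compatible n p a b) (hab : a < b) {x : ℝ} (hx : x ∈ Icc a b) :
    ∫ y in a..x, speed a b r y = ∑ i ∈ Finset.range (S.q + 2),
      arcCoeff n S.ν (speedCoeff p χ z) i *
        (basisOn b S.ρ (2 * n + 1) i x - basisOn b S.ρ (2 * n + 1) i a) := by
  have h : ∫ y in a..x, speed a b r y = ∫ y in a..x,
      ∑ k ∈ Finset.range (S.q + 1), basisOn b S.ν (2 * n) k y • speedCoeff p χ z k := by
    refine intervalIntegral.integral_congr fun y hy => ?_
    rw [uIcc_of_le hx.1] at hy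
    exact hr.speed_eq hχ hab ⟨hy.1, hy.2.trans hx.2⟩
  rw [h, hS.integral_sum_basisOn hab _ hx]
  refine Finset.sum_congr rfl fun i _ => ?_
  rw [arcCoeff_eq_sum, smul_eq_mul, mul_comm]

theorem IsRegularPH.sub_eq (hr : IsRegularPH n p a b S.μ z r) (hχ : S.IsChi n p b χ)
    (hS : S.Compatible n p a b) (hab : a < b) {x : ℝ} (hx : x ∈ Icc a b) :
    r x - r a = ∑ i ∈ Finset.range (S.q + 2), curveCoeff n S.ν (hodoCoeff p χ z) 0 i *
      ((basisOn b S.ρ (2 * n + 1) i x : ℂ) - (basisOn b S.ρ (2 * n + 1) i a : ℂ)) := by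
  have hsub : Icc a x ⊆ Icc a b := Icc_subset_Icc_right hx.2
  have h := intervalIntegral.integral_eq_sub_of_hasDeriv_right_of_le (f := r)
    (f' := fun y => ∑ k ∈ Finset.range (S.q + 1),
      basisOn b S.ν (2 * n) k y • hodoCoeff p χ z k) hx.1
    (fun y hy => ((hr.hodograph y (hsub hy)).continuousWithinAt).mono hsub)
    (fun y hy => by
      have hy' : y ∈ Ioo a b := ⟨hy.1, hy.2.trans_le hx.2⟩
      rw [← hχ.preimage_sq]
      exact ((hr.hodograph y (Ioo_subset_Icc_self hy')).hasDerivAt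
        (Icc_mem_nhds hy'.1 hy'.2)).hasDerivWithinAt)
    (hS.intervalIntegrable_sum_basisOn _ x)
  rw [← h, hS.integral_sum_basisOn hab _ hx]
  refine Finset.sum_congr rfl fun i _ => ?_
  rw [curveCoeff_eq_sum, zero_add, Complex.real_smul, Complex.ofReal_sub, mul_comm]

theorem Knots.Compatible.sum_basisOn_ρ (hS : S.Compatible n p a b) (hab : a < b) {x : ℝ}
    (hx : x ∈ Icc a b) :
    ∑ i ∈ Finset.range (S.q + 2), basisOn b S.ρ (2 * n + 1) i x = 1 :=
  sum_basisOn_eq_one hS.monotone_ρ (hS.ρ_le.trans hx.1) hS.le_ρ (hS.ρ_le.trans_lt hab) hx.2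

theorem Knots.Compatible.sum_curveCoeff (hS : S.Compatible n p a b) (hab : a < b) {x : ℝ}
    (hx : x ∈ Icc a b) (P : ℕ → ℂ) (r₀ : ℂ) :
    ∑ i ∈ Finset.range (S.q + 2), curveCoeff n S.ν P r₀ i * (basisOn b S.ρ (2 * n + 1) i x : ℂ) =
      r₀ + ∑ i ∈ Finset.range (S.q + 2),
        curveCoeff n S.ν P 0 i * (basisOn b S.ρ (2 * n + 1) i x : ℂ) := by
  have h : (∑ i ∈ Finset.range (S.q + 2), (basisOn b S.ρ (2 * n + 1) i x : ℂ)) = 1 := by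
    exact_mod_cast hS.sum_basisOn_ρ hab hx
  conv_rhs => rw [← mul_one r₀, ← h, Finset.mul_sum, ← Finset.sum_add_distrib]
  refine Finset.sum_congr rfl fun i _ => ?_
  rw [curveCoeff_eq_sum n S.ν P r₀, curveCoeff_eq_sum n S.ν P 0]
  ring

/-- By the partition of unity, changing r₀ translates the whole curve, so r₀ is fixed by the value
at a. -/
theorem IsRegularPH.existsUnique (hr : IsRegularPH n p a b S.μ z r) (hχ : S.IsChi n p b χ)
    (hS : S.Compatible n p a b) (hab : a < b) :
    ∃! r₀ : ℂ, ∀ x ∈ Icc a b, r x = ∑ i ∈ Finset.range (S.q + 2),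
      curveCoeff n S.ν (hodoCoeff p χ z) r₀ i * (basisOn b S.ρ (2 * n + 1) i x : ℂ) := by
  refine ⟨r a - ∑ i ∈ Finset.range (S.q + 2),
    curveCoeff n S.ν (hodoCoeff p χ z) 0 i * (basisOn b S.ρ (2 * n + 1) i a : ℂ),
    fun x hx => ?_, fun r₁ hr₁ => ?_⟩
  · rw [hS.sum_curveCoeff hab hx]
    have h := hr.sub_eq hχ hS hab hx
    simp only [mul_sub, Finset.sum_sub_distrib] at h
    linear_combination h
  · have h := hr₁ a (left_mem_Icc.2 hab.le)
    rw [hS.sum_curveCoeff hab (left_mem_Icc.2 hab.le)] at h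
    linear_combination -h

/-- R depends only on i and σ, P only on j, so the double sum factors. In the h-term the sum over i
is bare; on [a, b] it equals 1 and merely raises the degree. -/
theorem Knots.IsZeta.sum_offsetCoeff {ζ : ℕ → ℕ → ℕ → ℝ} (hζ : S.IsZeta n b ζ) (σ : ℕ → ℝ)
    (R P : ℕ → ℂ) (h x : ℝ) :
    ∑ k ∈ Finset.range (S.w + 1),
        offsetCoeff S.q ζ σ R P h k * (basisOn b S.τ (4 * n + 1) k x : ℂ) =
      (∑ i ∈ Finset.range (S.q + 2), R i * (basisOn b S.ρ (2 * n + 1) i x : ℂ)) *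
          (∑ j ∈ Finset.range (S.q + 1), (basisOn b S.ν (2 * n) j x • σ j : ℝ) : ℝ) -
        Complex.I * h * (∑ i ∈ Finset.range (S.q + 2), basisOn b S.ρ (2 * n + 1) i x : ℝ) *
          ∑ j ∈ Finset.range (S.q + 1), basisOn b S.ν (2 * n) j x • P j := by
  have e := sum_smul_eq_of_expansion (I := S.q + 2) (J := S.q + 1)
    (f := fun i j => basisOn b S.ρ (2 * n + 1) i x * basisOn b S.ν (2 * n) j x)
    (fun i hi j hj => hζ i (by omega) j (by omega) x)
    (fun i j => (σ j : ℂ) * R i - Complex.I * (h : ℂ) * P j)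
  simp only [Complex.real_smul, Complex.ofReal_mul, offsetCoeff, smul_eq_mul,
    Complex.ofReal_sum] at e ⊢
  have e' : ∑ k ∈ Finset.range (S.w + 1), (∑ i ∈ Finset.range (S.q + 2),
      ∑ j ∈ Finset.range (S.q + 1), ((σ j : ℂ) * R i - Complex.I * (h : ℂ) * P j) * (ζ i j k : ℂ)) *
        (basisOn b S.τ (4 * n + 1) k x : ℂ) =
      ∑ k ∈ Finset.range (S.w + 1), (basisOn b S.τ (4 * n + 1) k x : ℂ) *
        ∑ i ∈ Finset.range (S.q + 2), ∑ j ∈ Finset.range (S.q + 1),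
          (ζ i j k : ℂ) * ((σ j : ℂ) * R i - Complex.I * (h : ℂ) * P j) := by
    refine Finset.sum_congr rfl fun k _ => ?_
    rw [mul_comm]
    congr 1
    exact Finset.sum_congr rfl fun i _ => Finset.sum_congr rfl fun j _ => mul_comm _ _
  rw [e', ← e, mul_assoc, Finset.sum_mul_sum, Finset.sum_mul_sum, Finset.mul_sum,
    ← Finset.sum_sub_distrib]
  refine Finset.sum_congr rfl fun i _ => ?_
  rw [Finset.mul_sum, ← Finset.sum_sub_distrib]
  exact Finset.sum_congr rfl fun j _ => by ring

theorem Knots.IsZeta.sum_weight {ζ : ℕ → ℕ → ℕ → ℝ} (hζ : S.IsZeta n b ζ) (σ : ℕ → ℝ) (x : ℝ) :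
    ∑ k ∈ Finset.range (S.w + 1), weight S.q ζ σ k * basisOn b S.τ (4 * n + 1) k x =
      (∑ i ∈ Finset.range (S.q + 2), basisOn b S.ρ (2 * n + 1) i x) *
        ∑ j ∈ Finset.range (S.q + 1), basisOn b S.ν (2 * n) j x • σ j := by
  have e := sum_smul_eq_of_expansion (I := S.q + 2) (J := S.q + 1)
    (f := fun i j => basisOn b S.ρ (2 * n + 1) i x * basisOn b S.ν (2 * n) j x)
    (fun i hi j hj => hζ i (by omega) j (by omega) x) (fun _ j => σ j)
  simp only [smul_eq_mul, weight, Finset.sum_mul_sum] at e ⊢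
  simp only [← mul_assoc, e]
  refine Finset.sum_congr rfl fun k _ => ?_
  rw [mul_comm]
  congr 1
  exact Finset.sum_congr rfl fun i _ => Finset.sum_congr rfl fun j _ => mul_comm _ _

end curve

/-! ### Multiplicities in the general and the clamped knot vectors. -/

/-- `K` starts with the knots `{⟨α⟩^e, {⟨u k⟩^c}_{k=0..N-1}, ⟨β⟩^e}`. -/
structure IsBlockVec (K : ℕ → ℝ) (e c N : ℕ) (α β : ℝ) (u : ℕ → ℝ) : Prop where
  head : ∀ j < e, K j = α
  body : ∀ k < N, ∀ r < c, K (e + (c * k + r)) = u k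
  tail : ∀ j < e, K (e + c * N + j) = β

theorem sum_range_mul_eq (f : ℕ → ℕ) (c N : ℕ) :
    ∑ j ∈ Finset.range (c * N), f j =
      ∑ k ∈ Finset.range N, ∑ r ∈ Finset.range c, f (c * k + r) := by
  induction N with
  | zero => simp
  | succ N ih => rw [Nat.mul_succ, Finset.sum_range_add, ih, Finset.sum_range_succ]

theorem IsBlockVec.knotCount_eq {K : ℕ → ℝ} {e c N : ℕ} {α β : ℝ} {u : ℕ → ℝ}
    (h : IsBlockVec K e c N α β u) {L : ℕ} (hL : L + 1 = e + c * N + e) (x : ℝ) :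
    knotCount K L x = e * ((if α = x then 1 else 0) + (if β = x then 1 else 0)) +
      c * ∑ k ∈ Finset.range N, if u k = x then 1 else 0 := by
  rw [knotCount, hL, Finset.sum_range_add, Finset.sum_range_add, sum_range_mul_eq]
  have h₁ : ∑ j ∈ Finset.range e, (if K j = x then 1 else 0) = e * if α = x then 1 else 0 := by
    rw [Finset.sum_congr rfl fun j hj => by rw [h.head j (Finset.mem_range.1 hj)]]
    simp
  have h₂ : ∑ j ∈ Finset.range e, (if K (e + c * N + j) = x then 1 else 0) =
      e * if β = x then 1 else 0 := by
    rw [Finset.sum_congr rfl fun j hj => by rw [h.tail j (Finset.mem_range.1 hj)]]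
    simp
  have h₃ : ∑ k ∈ Finset.range N, ∑ r ∈ Finset.range c,
      (if K (e + (c * k + r)) = x then 1 else 0) =
      c * ∑ k ∈ Finset.range N, if u k = x then 1 else 0 := by
    rw [Finset.mul_sum]
    refine Finset.sum_congr rfl fun k hk => ?_
    rw [Finset.sum_congr rfl fun r hr => by
      rw [h.body k (Finset.mem_range.1 hk) r (Finset.mem_range.1 hr)]]
    simp
  rw [h₁, h₂, h₃]
  ring

/-- If x is the value of s end blocks and r inner blocks, the counts are es + cr and e's + c'r. One
block gaining g suffices, the others only must not shrink; absent end blocks (e = 0) impose nothing.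
-/
theorem IsBlockVec.add_knotCount_le {K K' : ℕ → ℝ} {e c e' c' N : ℕ} {α β : ℝ} {u : ℕ → ℝ}
    (h : IsBlockVec K e c N α β u) (h' : IsBlockVec K' e' c' N α β u) {L L' : ℕ}
    (hL : L + 1 = e + c * N + e) (hL' : L' + 1 = e' + c' * N + e') (g : ℕ) (hc : g + c ≤ c')
    (he : e ≤ e') (hge : 0 < e → g + e ≤ e') (x : ℝ) (hpos : 0 < knotCount K L x) :
    g + knotCount K L x ≤ knotCount K' L' x := by
  rw [h.knotCount_eq hL] at hpos ⊢
  rw [h'.knotCount_eq hL']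
  set s := (if α = x then 1 else 0) + (if β = x then 1 else 0)
  set r := ∑ k ∈ Finset.range N, if u k = x then 1 else 0
  rcases Nat.eq_zero_or_pos r with hr | hr
  · rw [hr] at hpos ⊢
    simp only [mul_zero, add_zero] at hpos ⊢
    have hs : 0 < s := Nat.pos_of_mul_pos_left hpos
    have := hge (Nat.pos_of_mul_pos_right hpos)
    nlinarith
  · have h₁ : e * s ≤ e' * s := Nat.mul_le_mul_right s he
    have h₂ : g + c * r ≤ c' * r := by nlinarith
    omega

theorem Int.ediv_eq_of_bounds {x c k : ℤ} (hc : 0 < c) (h₁ : k * c ≤ x) (h₂ : x < (k + 1) * c) :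
    x / c = k :=
  le_antisymm (Int.lt_add_one_iff.1 ((Int.ediv_lt_iff_lt_mul hc).2 h₂))
    ((Int.le_ediv_iff_mul_le hc).2 h₁)

/-- The end blocks are truncated blocks number -1 and N of the floor division, which is why `e ≤ c`
is needed. -/
theorem isBlockVec_of_ediv {t : ℤ → ℝ} {K : ℕ → ℝ} {e c : ℕ}
    (hK : ∀ i : ℕ, K i = t (((i : ℤ) - e) / c)) (he : e ≤ c) (hc : 0 < c) (N : ℕ) :
    IsBlockVec K e c N (t (-1)) (t N) fun k => t k := by
  have hc' : (0 : ℤ) < c := by exact_mod_cast hc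
  refine ⟨fun j hj => ?_, fun k _ r hr => ?_, fun j hj => ?_⟩
  · rw [hK, Int.ediv_eq_of_bounds hc' (k := -1)]
    · omega
    · omega
  · rw [hK, Int.ediv_eq_of_bounds hc' (k := k)]
    · push_cast; nlinarith
    · push_cast; nlinarith
  · rw [hK, Int.ediv_eq_of_bounds hc' (k := N)]
    · push_cast; nlinarith
    · push_cast; nlinarith

theorem monotone_of_ediv {t : ℤ → ℝ} (ht : Monotone t) {K : ℕ → ℝ} {e c : ℕ}
    (hK : ∀ i : ℕ, K i = t (((i : ℤ) - e) / c)) (hc : 0 < c) : Monotone K := by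
  intro i j hij
  rw [hK, hK]
  refine ht (Int.ediv_le_ediv (by exact_mod_cast hc) ?_)
  have : (i : ℤ) ≤ j := by exact_mod_cast hij
  linarith

theorem Knots.compatible_general (n p : ℕ) {t : ℤ → ℝ} (ht : Monotone t) :
    (Knots.general n p t).Compatible n p (t n) (t (p + 1)) := by
  set S := Knots.general n p t with hS
  have eμ : ∀ i : ℕ, S.μ i = t (((i : ℤ) - (0 : ℕ)) / (1 : ℕ)) := fun i => by
    simp [hS, Knots.general]
  have eν : ∀ i : ℕ, S.ν i = t (((i : ℤ) - (0 : ℕ)) / (n + 1 : ℕ)) := fun i => by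
    simp [hS, Knots.general]
  have eρ : ∀ i : ℕ, S.ρ i = t (((i : ℤ) - (1 : ℕ)) / (n + 1 : ℕ)) := fun i => by
    simp [hS, Knots.general]
  have eτ : ∀ i : ℕ, S.τ i = t (((i : ℤ) - (2 * n + 1 : ℕ)) / (3 * n + 2 : ℕ)) := fun i => by
    simp [hS, Knots.general]
  have hq : S.q = (n + 1) * (p + n) := rfl
  have hw : S.w + 1 = (3 * n + 2) * (p + n + 2) :=
    Nat.sub_add_cancel (Nat.succ_le_of_lt (by positivity))
  have hqz : (S.q : ℤ) = (n + 1) * (p + n) := by rw [hq]; push_cast; ring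
  have hwz : (S.w : ℤ) + 1 = (3 * n + 2) * (p + n + 2) := by exact_mod_cast hw
  have bμ := isBlockVec_of_ediv eμ (by omega) (by omega) (p + n + 2)
  have bν := isBlockVec_of_ediv eν (by omega) (by omega) (p + n + 2)
  have bρ := isBlockVec_of_ediv eρ (by omega) (by omega) (p + n + 2)
  have bτ := isBlockVec_of_ediv eτ (by omega) (by omega) (p + n + 2)
  have lν : S.q + 2 * n + 1 + 1 = 0 + (n + 1) * (p + n + 2) + 0 := by rw [hq]; ring
  have lρ : S.q + 1 + (2 * n + 1) + 1 + 1 = 1 + (n + 1) * (p + n + 2) + 1 := by rw [hq]; ring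
  have lτ : S.w + (4 * n + 1) + 1 + 1 = (2 * n + 1) + (3 * n + 2) * (p + n + 2) + (2 * n + 1) := by
    rw [← hw]; ring
  have hn : (0 : ℤ) ≤ n := by positivity
  have hp : (0 : ℤ) ≤ p := by positivity
  exact
    { monotone_μ := monotone_of_ediv ht eμ (by omega)
      monotone_ν := monotone_of_ediv ht eν (by omega)
      monotone_ρ := monotone_of_ediv ht eρ (by omega)
      monotone_τ := monotone_of_ediv ht eτ (by omega)
      ν_zero_le := by
        rw [eμ, eν]
        simp
      μ_last_le := by
        rw [eμ, eν]
        refine ht ((Int.le_ediv_iff_mul_le (by positivity)).2 ?_)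
        push_cast
        rw [hqz, Int.ediv_one]
        nlinarith
      τ_zero_le := by
        rw [eτ, eρ]
        -- Both floor quotients are compared with -1.
        refine ht (le_trans (Int.lt_add_one_iff.1 ((Int.ediv_lt_iff_lt_mul (by positivity)).2 ?_))
          ((Int.le_ediv_iff_mul_le (by positivity)).2 (?_ : (-1 : ℤ) * _ ≤ _)))
        · push_cast
          linarith
        · push_cast
          linarith
      ρ_last_le := by
        rw [eτ, eρ]
        refine ht (le_trans (Int.lt_add_one_iff.1 ((Int.ediv_lt_iff_lt_mul (by positivity)).2 ?_))
          ((Int.le_ediv_iff_mul_le (by positivity)).2 (?_ : ((p : ℤ) + n + 2) * _ ≤ _)))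
        · push_cast
          rw [hqz]
          nlinarith
        · push_cast
          linarith
      count_μ_ν := bμ.add_knotCount_le bν (by ring) lν n (by omega) (by omega) (by omega)
      count_ρ_τ := bρ.add_knotCount_le bτ lρ lτ (2 * n) (by omega) (by omega) (by omega)
      count_ν_τ := bν.add_knotCount_le bτ lν lτ (2 * n + 1) (by omega) (by omega) (by omega)
      ρ_succ := fun j => by
        rw [eρ, eν]
        simp
      ρ_le := by
        rw [eρ]
        -- The quotient of 2n by n + 1 is at most n, since 2n < (n + 1)².
        refine ht (Int.lt_add_one_iff.1 ((Int.ediv_lt_iff_lt_mul (by positivity)).2 ?_))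
        push_cast
        nlinarith
      le_ρ := by
        rw [eρ]
        -- The inequality (p + 1)(n + 1) ≤ q + 1 is an equality for n = 0.
        refine ht ((Int.le_ediv_iff_mul_le (by positivity)).2 ?_)
        push_cast
        rw [hqz]
        nlinarith }

theorem clampedVec_of_le {n m : ℕ} {t : ℤ → ℝ} {e c i : ℕ} (hi : e ≤ i) :
    clampedVec n m t e c i = t (min (m + 1) (n + 1 + (i - e) / c) : ℕ) :=
  if_neg hi.not_gt

theorem clampedVec_of_lt {n m : ℕ} {t : ℤ → ℝ} {e c i : ℕ} (hi : i < e) :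
    clampedVec n m t e c i = t n :=
  if_pos hi

theorem monotone_clampedVec {n m : ℕ} (hnm : n ≤ m) {t : ℤ → ℝ} (ht : Monotone t) (e c : ℕ) :
    Monotone (clampedVec n m t e c) := by
  intro i j hij
  rcases lt_or_ge i e with hi | hi
  · rw [clampedVec_of_lt hi]
    rcases lt_or_ge j e with hj | hj
    · rw [clampedVec_of_lt hj]
    · rw [clampedVec_of_le hj]
      exact ht (Int.ofNat_le.2 (le_min (by omega)
        ((Nat.le_succ n).trans (Nat.le_add_right _ _))))
  · rw [clampedVec_of_le hi, clampedVec_of_le (hi.trans hij)]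
    refine ht (Int.ofNat_le.2 (min_le_min le_rfl (Nat.add_le_add_left ?_ _)))
    exact Nat.div_le_div_right (by omega)

theorem clampedVec_of_ge {n m : ℕ} (hnm : n ≤ m) {t : ℤ → ℝ} {e c i : ℕ} (hc : 0 < c)
    (hi : e + c * (m - n) ≤ i) : clampedVec n m t e c i = t (m + 1) := by
  have h : m - n ≤ (i - e) / c := (Nat.le_div_iff_mul_le hc).2 (by rw [mul_comm]; omega)
  rw [clampedVec_of_le ((Nat.le_add_right _ _).trans hi), min_eq_left (by omega)]
  push_cast
  rfl

theorem isBlockVec_clampedVec {n m : ℕ} (hnm : n ≤ m) {t : ℤ → ℝ} {e c : ℕ} (hc : 0 < c) :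
    IsBlockVec (clampedVec n m t e c) e c (m - n) (t n) (t (m + 1))
      fun k => t (n + 1 + k : ℕ) := by
  refine ⟨fun j hj => clampedVec_of_lt hj, fun k hk r hr => ?_, fun j _ => ?_⟩
  · have h : (e + (c * k + r) - e) / c = k := by
      rw [Nat.add_sub_cancel_left, Nat.mul_add_div hc, Nat.div_eq_of_lt hr, add_zero]
    rw [clampedVec_of_le (Nat.le_add_right _ _), h, min_eq_right (by omega)]
  · exact clampedVec_of_ge hnm hc (by omega)

theorem Knots.compatible_clamped {n p : ℕ} (hnp : n ≤ p) {t : ℤ → ℝ} (ht : Monotone t) :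
    (Knots.clamped n p t).Compatible n p (t n) (t (p + 1)) := by
  set S := Knots.clamped n p t with hS
  have hq : S.q = 2 * n + (n + 1) * (p - n) := rfl
  have hw : S.w = 4 * n + 1 + (p - n) * (3 * n + 2) := rfl
  have bμ : IsBlockVec S.μ _ _ _ _ _ _ :=
    isBlockVec_clampedVec (t := t) hnp (e := n + 1) (c := 1) (by omega)
  have bν : IsBlockVec S.ν _ _ _ _ _ _ :=
    isBlockVec_clampedVec (t := t) hnp (e := 2 * n + 1) (c := n + 1) (by omega)
  have bρ : IsBlockVec S.ρ _ _ _ _ _ _ :=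
    isBlockVec_clampedVec (t := t) hnp (e := 2 * n + 2) (c := n + 1) (by omega)
  have bτ : IsBlockVec S.τ _ _ _ _ _ _ :=
    isBlockVec_clampedVec (t := t) hnp (e := 4 * n + 2) (c := 3 * n + 2) (by omega)
  have lμ : p + n + 1 + 1 = n + 1 + 1 * (p - n) + (n + 1) := by omega
  have lν : S.q + 2 * n + 1 + 1 = 2 * n + 1 + (n + 1) * (p - n) + (2 * n + 1) := by
    rw [hq]; ring
  have lρ : S.q + 1 + (2 * n + 1) + 1 + 1 = 2 * n + 2 + (n + 1) * (p - n) + (2 * n + 2) := by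
    rw [hq]; ring
  have lτ : S.w + (4 * n + 1) + 1 + 1 =
      4 * n + 2 + (3 * n + 2) * (p - n) + (4 * n + 2) := by
    rw [hw]; ring
  exact
    { monotone_μ := monotone_clampedVec hnp ht _ _
      monotone_ν := monotone_clampedVec hnp ht _ _
      monotone_ρ := monotone_clampedVec hnp ht _ _
      monotone_τ := monotone_clampedVec hnp ht _ _
      ν_zero_le := by rw [bν.head 0 (by omega), bμ.head 0 (by omega)]
      μ_last_le := by
        refine le_of_eq ((clampedVec_of_ge hnp (by omega) (by omega)).trans
          (clampedVec_of_ge hnp (by omega) (by omega)).symm)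
      τ_zero_le := by rw [bτ.head 0 (by omega), bρ.head 0 (by omega)]
      ρ_last_le := by
        refine le_of_eq ((clampedVec_of_ge hnp (by omega) (by omega)).trans
          (clampedVec_of_ge hnp (by omega) (by omega)).symm)
      count_μ_ν := bμ.add_knotCount_le bν lμ lν n (by omega) (by omega) (by omega)
      count_ρ_τ := bρ.add_knotCount_le bτ lρ lτ (2 * n) (by omega) (by omega) (by omega)
      count_ν_τ := bν.add_knotCount_le bτ lν lτ (2 * n + 1) (by omega) (by omega) (by omega)
      ρ_succ := fun j => by
        change clampedVec n p t (2 * n + 2) (n + 1) (j + 1) = clampedVec n p t (2 * n + 1) (n + 1) j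
        rcases lt_or_ge j (2 * n + 1) with hj | hj
        · rw [clampedVec_of_lt hj, clampedVec_of_lt (by omega)]
        · rw [clampedVec_of_le hj, clampedVec_of_le (by omega),
            show j + 1 - (2 * n + 2) = j - (2 * n + 1) by omega]
      ρ_le := le_of_eq (bρ.head _ (by omega))
      le_ρ := le_of_eq (clampedVec_of_ge hnp (by omega) (by rw [hq]; omega)).symm }

end PHSpline

/-! ### The main theorem. -/

theorem mainTheorem3 (n p : ℕ) (hnp : n ≤ p) (t : ℤ → ℝ) (ht : Monotone t)
    (hab : t n < t (p + 1)) (S : PHSpline.Knots)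
    (hS : S = PHSpline.Knots.general n p t ∨ S = PHSpline.Knots.clamped n p t) :
    -- the products of B-splines can be expanded in the bases over `ν` and over `τ`
    (∃ χ, S.IsChi n p (t (p + 1)) χ) ∧
    (∃ ζ, S.IsZeta n (t (p + 1)) ζ) ∧
    -- if no basis function degenerates, the coefficients are the unique solutions of Gram systems
    ((∀ k ≤ S.q, S.ν k < S.ν (k + 2 * n + 1)) →
      (PHSpline.gram S.ν (2 * n) S.q).det ≠ 0 ∧
      ∀ i ≤ p, ∀ j ≤ p, ∀ c : ℕ → ℝ,
        ((PHSpline.gram S.ν (2 * n) S.q).mulVec (fun k => c k) =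
          PHSpline.moments S.ν (2 * n) S.q (fun x =>
            PHSpline.basisOn (t (p + 1)) S.μ n i x * PHSpline.basisOn (t (p + 1)) S.μ n j x)) ↔
        PHSpline.IsExpansion (t (p + 1)) S.ν (2 * n) S.q c (fun x =>
            PHSpline.basisOn (t (p + 1)) S.μ n i x * PHSpline.basisOn (t (p + 1)) S.μ n j x)) ∧
    ((∀ k ≤ S.w, S.τ k < S.τ (k + 4 * n + 2)) →
      (PHSpline.gram S.τ (4 * n + 1) S.w).det ≠ 0 ∧
      ∀ i ≤ S.q + 1, ∀ j ≤ S.q, ∀ c : ℕ → ℝ,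
        ((PHSpline.gram S.τ (4 * n + 1) S.w).mulVec (fun k => c k) =
          PHSpline.moments S.τ (4 * n + 1) S.w (fun x =>
            PHSpline.basisOn (t (p + 1)) S.ρ (2 * n + 1) i x *
              PHSpline.basisOn (t (p + 1)) S.ν (2 * n) j x)) ↔
        PHSpline.IsExpansion (t (p + 1)) S.τ (4 * n + 1) S.w c (fun x =>
            PHSpline.basisOn (t (p + 1)) S.ρ (2 * n + 1) i x *
              PHSpline.basisOn (t (p + 1)) S.ν (2 * n) j x)) ∧
    -- for any such coefficients and every regular PH B-spline curve `r` with preimage `z`: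
    ∀ χ, S.IsChi n p (t (p + 1)) χ → ∀ ζ, S.IsZeta n (t (p + 1)) ζ →
    ∀ (z : ℕ → ℂ) (r : ℝ → ℂ), PHSpline.IsRegularPH n p (t n) (t (p + 1)) S.μ z r →
      -- the parametric speed
      (∀ x ∈ Set.Icc (t n) (t (p + 1)),
        PHSpline.speed (t n) (t (p + 1)) r x =
          ∑ k ∈ Finset.range (S.q + 1),
            PHSpline.speedCoeff p χ z k * PHSpline.basisOn (t (p + 1)) S.ν (2 * n) k x) ∧
      -- the arc length
      (∀ x ∈ Set.Icc (t n) (t (p + 1)),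
        ∫ y in (t n)..x, PHSpline.speed (t n) (t (p + 1)) r y =
          ∑ i ∈ Finset.range (S.q + 2),
            PHSpline.arcCoeff n S.ν (PHSpline.speedCoeff p χ z) i *
              (PHSpline.basisOn (t (p + 1)) S.ρ (2 * n + 1) i x -
                PHSpline.basisOn (t (p + 1)) S.ρ (2 * n + 1) i (t n))) ∧
      -- the control points of `r` are determined by a unique `r₀`
      (∃! r₀ : ℂ, ∀ x ∈ Set.Icc (t n) (t (p + 1)),
        r x = ∑ i ∈ Finset.range (S.q + 2),
          PHSpline.curveCoeff n S.ν (PHSpline.hodoCoeff p χ z) r₀ i *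
            (PHSpline.basisOn (t (p + 1)) S.ρ (2 * n + 1) i x : ℂ)) ∧
      -- and the offset curve is the rational B-spline curve with weights `γ_k` and points `q_k`
      ∀ r₀ : ℂ, (∀ x ∈ Set.Icc (t n) (t (p + 1)),
        r x = ∑ i ∈ Finset.range (S.q + 2),
          PHSpline.curveCoeff n S.ν (PHSpline.hodoCoeff p χ z) r₀ i *
            (PHSpline.basisOn (t (p + 1)) S.ρ (2 * n + 1) i x : ℂ)) →
        ∀ h : ℝ, ∀ x ∈ Set.Icc (t n) (t (p + 1)),
          0 < ∑ k ∈ Finset.range (S.w + 1),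
            PHSpline.weight S.q ζ (PHSpline.speedCoeff p χ z) k *
              PHSpline.basisOn (t (p + 1)) S.τ (4 * n + 1) k x ∧
          PHSpline.offset (t n) (t (p + 1)) r h x =
            (∑ k ∈ Finset.range (S.w + 1),
              PHSpline.offsetCoeff S.q ζ (PHSpline.speedCoeff p χ z)
                  (PHSpline.curveCoeff n S.ν (PHSpline.hodoCoeff p χ z) r₀)
                  (PHSpline.hodoCoeff p χ z) h k *
                (PHSpline.basisOn (t (p + 1)) S.τ (4 * n + 1) k x : ℂ)) /
            ((∑ k ∈ Finset.range (S.w + 1),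
              PHSpline.weight S.q ζ (PHSpline.speedCoeff p χ z) k *
                PHSpline.basisOn (t (p + 1)) S.τ (4 * n + 1) k x : ℝ) : ℂ) := by
  have hcomp : S.Compatible n p (t n) (t (p + 1)) := by
    rcases hS with rfl | rfl
    · exact PHSpline.Knots.compatible_general n p ht
    · exact PHSpline.Knots.compatible_clamped hnp ht
  have hex := hcomp.exists_isChi (t (p + 1))
  refine ⟨hex, hcomp.exists_isZeta (t (p + 1)), fun hdeg => ?_, fun hdeg => ?_, ?_⟩
  · obtain ⟨χ, hχ⟩ := hex
    exact ⟨PHSpline.det_gram_ne_zero hcomp.monotone_ν hdeg, fun i hi j hj =>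
      PHSpline.gram_system hcomp.monotone_ν hdeg ⟨_, hχ.expand i hi j hj⟩⟩
  · exact ⟨PHSpline.det_gram_ne_zero hcomp.monotone_τ hdeg, fun i hi j hj =>
      PHSpline.gram_system hcomp.monotone_τ hdeg (hcomp.exists_expansion_τ _ hi hj)⟩
  intro χ hχ ζ hζ z r hr
  refine ⟨fun x hx => ?_, fun x hx => hr.integral_speed hχ hcomp hab hx,
    hr.existsUnique hχ hcomp hab, fun r₀ hr₀ h x hx => ?_⟩
  · rw [hr.speed_eq hχ hab hx]
    exact Finset.sum_congr rfl fun k _ => by rw [smul_eq_mul, mul_comm]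
  · have hpos := hr.speed_pos hab hx
    -- The denominator is the speed times the partition of unity, hence the speed itself, which is
    -- positive by regularity.
    rw [hζ.sum_weight, hcomp.sum_basisOn_ρ hab hx, one_mul, ← hr.speed_eq hχ hab hx]
    refine ⟨hpos, ?_⟩
    -- The numerator becomes r|r'| - i h r'; dividing by |r'| gives the offset curve.
    rw [hζ.sum_offsetCoeff, ← hr₀ x hx, hcomp.sum_basisOn_ρ hab hx, ← hr.speed_eq hχ hab hx,
      ← hχ.preimage_sq, PHSpline.offset, hr.derivWithin_eq hab hx]
    have hne : (PHSpline.speed (t n) (t (p + 1)) r x : ℂ) ≠ 0 := by exact_mod_cast hpos.ne'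
    field_simp
    push_cast
    ring
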